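/- All logarithms are to base $2$. Write $\sigma\in S_n$ as the vector $(\sigma_1,\dots,\sigma_n)$ of symbols $1,\dots,n$. A burst stable deletion of length $t$ replaces $\sigma$ by $(\sigma_1,\dots,\sigma_i,\sigma_{i+t+1},\dots,\sigma_n)$ for some $0\le i\le n-t$. A code $\mathcal C\subseteq S_n$ is a $^{\le}s$-BSD permutation code if for any two distinct codewords the sets of vectors obtainable from them by a burst stable deletion of length at most $s$ are disjoint; its redundancy is $\log|S_n|-\log|\mathcal C|$. **Notation.** For a vector $u$ of length $m$: $\mathrm{Sum}(u)=\sum_i u_i$; $\mathrm{VT}(u)=\sum_{i=1}^m i\,u_i$; the signature $\alpha(u)\in\{0,1\}^{m-1}$ has $\alpha(u)_i=1$ iff $u_{i+1}\ge u_i$; the permutation projection is $\beta(u)_i=|\{j:u_j<u_i\}|+|\{j\le i:u_j=u_i\}|$; $\mu(u)$ is the lexicographic rank (counted from $1$) of $\beta(u)$ in $S_m$; $u_{(k,1)}=(u_1,u_{k+1},u_{2k+1},\dots)$ is the first row of the array with $k$ rows filled with $u$ column by column, and $u^{(k,j)}=(u_{(j-1)k+1},\dots,u_{jk})$ is its $j$-th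 column. $\mathrm{SVT}_{b,b'}(P)$ is the set of binary vectors $x$ (of the relevant length) with $\mathrm{VT}(x)\equiv b\pmod P$ and $\mathrm{Sum}(x)\equiv b'\pmod 2$. The parity indicator vector $\mathbb 1(\sigma)$ has $i$-th entry $1$ iff $\sigma_i$ is odd. Fix $s\ge1$. Let $\delta=s2^{2s+1}\lceil\log n\rceil$, $p=0^s1^s$ and $P_k=\lceil(\delta+k-1)/k\rceil$ for $1\le k\le s$. Call $n\geq 1$ admissible if $s\mid n$, $n/s$ is even, and $n$ is a multiple of $2\prod_{k=1}^s kP_k$. * *Locate.* $\mathcal L_{a_1,a_2}$ is the set of $x\in\{0,1\}^n$ such that every interval of $\delta$ consecutive entries of $x$ contains $p$ as a consecutive subsequence ($x$ is $(p,\delta)$-dense), the number $n_p(x)$ of occurrences of $p$ in $x$ is $\equiv a_1\pmod 4$, and $\mathrm{VT}(\alpha_p(x))\equiv a_2\pmod{2n}$. Here $\alpha_p(x)$, of length $n_p(x)+1$, lists the distances between consecutive ones of $(1,\mathbb 1_p(x),1)$, where $\mathbb 1_p(x)\in\{0,1\}^n$ marks the starting positions of the occurrences of $p$. * *Recover.*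 $\mathcal R_{d_1,d_2}(k)$ is the set of $\sigma\in S_n$ with $\sum_{i=1}^{n/2k}\mu(\sigma^{(k,2i-1)},\sigma^{(k,2i)})\equiv d_1$ and $\sum_{i=1}^{n/2k}\mu(\sigma^{(k,2i)},\sigma^{(k,2i+1)})\equiv d_2\pmod{(2k)!}$, where $\sigma^{(k,n/k+1)}=\sigma^{(k,1)}$. * *PSVT.* $\mathrm{PSVT}_{b,b',c,c'}(k,P)$ is the set of $\sigma\in S_n$ with $\alpha(\sigma_{(k,1)})\in\mathrm{SVT}_{b,b'}(P)$, $\sum_{i=1}^{n/2Pk}\mathrm{Sum}\big(\beta(B_{2i-1},B_{2i})_{(k,1)}\big)\equiv c$ and $\sum_{i=1}^{n/2Pk}\mathrm{Sum}\big(\beta(B_{2i},B_{2i+1})_{(k,1)}\big)\equiv c'\pmod{2Pk}$, where $B_j=(\sigma_{(j-1)Pk+1},\dots,\sigma_{jPk})$ and $B_{n/Pk+1}=B_1$. For $a_1\in\mathbb Z_4$, $a_2\in\mathbb Z_{2n}$, $b_{2k-1}\in\mathbb Z_{P_k}$, $b_{2k}\in\mathbb Z_2$ ($1\le k\le s$),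 $c_{2k-1},c_{2k}\in\mathbb Z_{2kP_k}$ ($2\le k\le s$) and $d_1,d_2\in\mathbb Z_{(4s)!}$, let $\mathcal C_s^3=\mathcal C_s^3(n;a;b,c;d)$ be the set of all $\sigma\in S_n$ with $\mathbb 1(\sigma)\in\mathcal L_{a_1,a_2}$, $\alpha(\sigma)\in\mathrm{SVT}_{b_1,b_2}(P_1)$, $\sigma\in\mathcal R_{d_1,d_2}(2s)$, and $\sigma\in\mathrm{PSVT}_{b_{2k-1},b_{2k},c_{2k-1},c_{2k}}(k,P_k)$ for all $2\le k\le s$. **Theorem.** For every $s\ge 1$, every admissible $n$ and all parameters $a,b,c,d$, the code $\mathcal C_s^3(n;a;b,c;d)$ is a $^{\le}s$-BSD permutation code. Moreover, there is a constant $K$ depending only on $s$ such that for every admissible $n$ the parameters can be chosen so that $\mathcal C_s^3(n;a;b,c;d)$ is a nonempty $^{\le}s$-BSD permutation code with redundancy at most $\log n+(3s-2)\log\log n+K$. -/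

import Mathlib

namespace BurstDeletion

/-! ### Vectors

A vector of length `n` is a function `Fin n → ℕ`, so that the (1-based) entry `u_{i+1}` is `u i`.
A binary vector is a function `Fin n → Fin 2`. -/

/-- The `k`-th entry of `u` with positions counted from `0`; the default value `0` outside the
range is never used when the divisibility assumptions on the length hold. -/
def entry {n : ℕ} (u : Fin n → ℕ) (k : ℕ) : ℕ := if h : k < n then u ⟨k, h⟩ else 0

/-- The one-line notation `(σ_1, …, σ_n)` of a permutation, with symbols `1, …, n`. -/
def permVec {n : ℕ} (σ : Equiv.Perm (Fin n)) : Fin n → ℕ := fun i => (σ i : ℕ) + 1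

/-- First row of the `s × (n/s)` array (filled column by column) representing `u`, i.e.
`(u_1, u_{s+1}, u_{2s+1}, …)`. -/
def firstRow {n : ℕ} (s : ℕ) (u : Fin n → ℕ) : Fin (n / s) → ℕ := fun j => entry u (j * s)

/-- The `k`-th (from `0`) block of `m` consecutive entries of `u`. With `m = s` it is column number
`k + 1` of the `s × (n/s)` array. With `m = P * s` it is the subarray formed by the columns
`k * P + 1, …, (k + 1) * P` of the `s × (n/s)` array, read column by column. -/
def block {n : ℕ} (m : ℕ) (u : Fin n → ℕ) (k : ℕ) : Fin m → ℕ := fun j => entry u (k * m + j)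

/-- `VT(x) = ∑ i x_i`, with `i` running from `1`. -/
def VT {m : ℕ} (x : Fin m → ℕ) : ℕ := ∑ i : Fin m, ((i : ℕ) + 1) * x i

/-- The signature of a vector: entry `1` where `x_i ≤ x_{i+1}` and `0` elsewhere. -/
def signature {n : ℕ} (x : Fin n → ℕ) : Fin (n - 1) → Fin 2 :=
  fun i => if x ⟨i, by omega⟩ ≤ x ⟨i + 1, by omega⟩ then 1 else 0

/-- The binary shifted VT code `SVT_{b₁,b₂}(m, P)` of length `m`. -/
def SVT (m P : ℕ) (b₁ : ZMod P) (b₂ : ZMod 2) : Set (Fin m → Fin 2) :=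
  {x | (VT (fun i => (x i : ℕ)) : ZMod P) = b₁ ∧ ((∑ i, (x i : ℕ) : ℕ) : ZMod 2) = b₂}

/-! ### Burst stable deletions -/

/-- All vectors that result from `σ` by a burst stable deletion of length `t`: for some `i` the
entries number `i + 1, …, i + t` are removed. -/
def burstBall {n : ℕ} (t : ℕ) (σ : Equiv.Perm (Fin n)) : Set (List ℕ) :=
  {w | ∃ i, i + t ≤ n ∧
    w = (List.ofFn (permVec σ)).take i ++ (List.ofFn (permVec σ)).drop (i + t)}

/-- `C` corrects a burst stable deletion of length at most `s`: the sets of possible results of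
such deletions from distinct codewords are disjoint. -/
def IsLeBSDCode {n : ℕ} (s : ℕ) (C : Set (Equiv.Perm (Fin n))) : Prop :=
  ∀ σ ∈ C, ∀ τ ∈ C, σ ≠ τ → Disjoint (⋃ t ≤ s, burstBall t σ) (⋃ t ≤ s, burstBall t τ)

/-- `log₂ |S_n| - log₂ |C|`. -/
noncomputable def redundancy {n : ℕ} (C : Set (Equiv.Perm (Fin n))) : ℝ :=
  Real.logb 2 (Nat.card (Equiv.Perm (Fin n))) - Real.logb 2 C.ncard

/-! ### Permutation projection, permutation rank -/

/-- The permutation projection `β(u)`: rank of each entry, ties broken by position. -/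
def projection {m : ℕ} (u : Fin m → ℕ) : Fin m → ℕ := fun i =>
  (Finset.univ.filter fun j => u j < u i).card +
    (Finset.univ.filter fun j => u j = u i ∧ j ≤ i).card

/-- The lexicographic rank in `S_m` (from `1`) of a permutation given in one-line notation `v`:
the number of permutations that are lexicographically smaller than or equal to `v`. -/
def lexRank {m : ℕ} (v : Fin m → ℕ) : ℕ :=
  (Finset.univ.filter fun π : Equiv.Perm (Fin m) =>
    permVec π = v ∨ ∃ j, (∀ i, i < j → permVec π i = v i) ∧ permVec π j < v j).card

/-- The permutation rank `μ(u)`, the lexicographic rank of the permutation projection. -/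
def permRank {m : ℕ} (u : Fin m → ℕ) : ℕ := lexRank (projection u)

/-! ### The retrieve, recover and PSVT constraints -/

/-- The pair of consecutive blocks number `k`, `k + 1` (from `0`) of `m` entries each, concatenated;
the block after the last one is the first one. -/
def blockPair {n : ℕ} (m : ℕ) (u : Fin n → ℕ) (k : ℕ) : Fin (m + m) → ℕ :=
  Fin.append (block m u k) (block m u ((k + 1) % (n / m)))

/-- `Sum(β(v)_{(s,1)})`, the sum of the first row of the projection of `v` in an array with
`s` rows. -/
def firstRowSum {m : ℕ} (s : ℕ) (v : Fin m → ℕ) : ℕ := ∑ j, firstRow s (projection v) j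

/-- `C^retrieve_{c₁,c₂}(n, s, P)`. -/
def retrieve (n s P : ℕ) (c₁ c₂ : ZMod (2 * P * s)) : Set (Equiv.Perm (Fin n)) :=
  {σ | ((∑ i ∈ Finset.range (n / (2 * P * s)),
          firstRowSum s (blockPair (P * s) (permVec σ) (2 * i)) : ℕ) : ZMod (2 * P * s)) = c₁ ∧
       ((∑ i ∈ Finset.range (n / (2 * P * s)),
          firstRowSum s (blockPair (P * s) (permVec σ) (2 * i + 1)) : ℕ) : ZMod (2 * P * s)) = c₂}

/-- `C^recover_{d₁,d₂}(n, s)`. -/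
def recover (n s : ℕ) (d₁ d₂ : ZMod (2 * s).factorial) : Set (Equiv.Perm (Fin n)) :=
  {σ | ((∑ i ∈ Finset.range (n / (2 * s)),
          permRank (blockPair s (permVec σ) (2 * i)) : ℕ) : ZMod (2 * s).factorial) = d₁ ∧
       ((∑ i ∈ Finset.range (n / (2 * s)),
          permRank (blockPair s (permVec σ) (2 * i + 1)) : ℕ) : ZMod (2 * s).factorial) = d₂}

/-- `PSVT_{b₁,b₂,c₁,c₂}(n, s, P)`. -/
def PSVT (n s P : ℕ) (b₁ : ZMod P) (b₂ : ZMod 2) (c₁ c₂ : ZMod (2 * P * s)) :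
    Set (Equiv.Perm (Fin n)) :=
  {σ | σ ∈ retrieve n s P c₁ c₂ ∧
    signature (firstRow s (permVec σ)) ∈ SVT (n / s - 1) P b₁ b₂}

/-! ### The locate constraint -/

/-- The pattern `p` occurs in `x` as a consecutive subsequence starting at position `i`
(from `0`). -/
def OccursAt {n m : ℕ} (p : Fin m → Fin 2) (x : Fin n → Fin 2) (i : ℕ) : Prop :=
  ∃ h : i + m ≤ n, ∀ j : Fin m, x ⟨i + j, by omega⟩ = p j

instance {n m : ℕ} (p : Fin m → Fin 2) (x : Fin n → Fin 2) (i : ℕ) : Decidable (OccursAt p x i) :=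
  inferInstanceAs (Decidable (∃ h : i + m ≤ n, ∀ j : Fin m, x ⟨i + j, by omega⟩ = p j))

/-- The `p`-indicator vector of `x`. -/
def indicator {n m : ℕ} (p : Fin m → Fin 2) (x : Fin n → Fin 2) : Fin n → Fin 2 :=
  fun i => if OccursAt p x i then 1 else 0

/-- `n_p(x)`, the number of ones in the `p`-indicator vector. -/
def numOcc {n m : ℕ} (p : Fin m → Fin 2) (x : Fin n → Fin 2) : ℕ :=
  (Finset.univ.filter fun i => indicator p x i = 1).card

/-- The increasing list of the positions of the ones in the vector `(1, indicator p x, 1)`. -/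
def markers {n m : ℕ} (p : Fin m → Fin 2) (x : Fin n → Fin 2) : List (Fin (n + 2)) :=
  (List.finRange (n + 2)).filter fun k =>
    (Fin.cons 1 (Fin.snoc (indicator p x) 1 : Fin (n + 1) → Fin 2) : Fin (n + 2) → Fin 2) k = 1

/-- `α_p(x)`, the vector of length `n_p(x) + 1` of the distances between consecutive ones in
`(1, indicator p x, 1)`. -/
def gaps {n m : ℕ} (p : Fin m → Fin 2) (x : Fin n → Fin 2) : Fin (numOcc p x + 1) → ℕ :=
  fun i => ((markers p x).getD (i + 1) 0 : ℕ) - ((markers p x).getD i 0 : ℕ)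

/-- `x` is `(p, δ)`-dense: each interval of length `δ` contains an occurrence of `p`. -/
def IsDense {n m : ℕ} (p : Fin m → Fin 2) (δ : ℕ) (x : Fin n → Fin 2) : Prop :=
  ∀ i, i + δ ≤ n → ∃ j, i ≤ j ∧ j + m ≤ i + δ ∧ OccursAt p x j

/-- The pattern `0^s 1^s`. -/
def pattern (s : ℕ) : Fin (2 * s) → Fin 2 := fun j => if (j : ℕ) < s then 0 else 1

/-- `δ = s 2^{2s+1} ⌈log₂ n⌉`. -/
def delta (n s : ℕ) : ℕ := s * 2 ^ (2 * s + 1) * Nat.clog 2 n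

/-- `C^locate_{a₁,a₂}(n, s)`. -/
def locate (n s : ℕ) (a₁ : ZMod 4) (a₂ : ZMod (2 * n)) : Set (Fin n → Fin 2) :=
  {x | IsDense (pattern s) (delta n s) x ∧
    (numOcc (pattern s) x : ZMod 4) = a₁ ∧ (VT (gaps (pattern s) x) : ZMod (2 * n)) = a₂}

/-- The parity indicator vector: entry `1` at odd symbols, `0` at even symbols. -/
def parity {n : ℕ} (u : Fin n → ℕ) : Fin n → Fin 2 := fun i => if Odd (u i) then 1 else 0

/-! ### The code -/

/-- `P_k = ⌈(δ + k - 1) / k⌉`, for `1 ≤ k ≤ s`. -/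
def windowLen (n s k : ℕ) : ℕ := (delta n s + k - 1) ⌈/⌉ k

/-- The standing assumptions on the length `n`. -/
def Admissible (n s : ℕ) : Prop :=
  0 < n ∧ s ∣ n ∧ Even (n / s) ∧ 2 * ∏ k ∈ Finset.Icc 1 s, k * windowLen n s k ∣ n

/-- The parameters of the code. Here `bOdd k`, `bEven k`, `cOdd k`, `cEven k` are
`b_{2k-1}`, `b_{2k}`, `c_{2k-1}`, `c_{2k}`; the code uses `bOdd k` and `bEven k` for `1 ≤ k ≤ s`,
and `cOdd k` and `cEven k` for `2 ≤ k ≤ s`, only. -/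
structure Params (n s : ℕ) where
  a₁ : ZMod 4
  a₂ : ZMod (2 * n)
  bOdd : ∀ k : ℕ, ZMod (windowLen n s k)
  bEven : ℕ → ZMod 2
  cOdd : ∀ k : ℕ, ZMod (2 * windowLen n s k * k)
  cEven : ∀ k : ℕ, ZMod (2 * windowLen n s k * k)
  d₁ : ZMod (2 * (2 * s)).factorial
  d₂ : ZMod (2 * (2 * s)).factorial

/-- The code `C_s^3(n; a; b, c; d)`. -/
def code (n s : ℕ) (q : Params n s) : Set (Equiv.Perm (Fin n)) :=
  {σ | parity (permVec σ) ∈ locate n s q.a₁ q.a₂ ∧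
    signature (permVec σ) ∈ SVT (n - 1) (windowLen n s 1) (q.bOdd 1) (q.bEven 1) ∧
    σ ∈ recover n (2 * s) q.d₁ q.d₂ ∧
    ∀ k, 2 ≤ k → k ≤ s →
      σ ∈ PSVT n k (windowLen n s k) (q.bOdd k) (q.bEven k) (q.cOdd k) (q.cEven k)}

end BurstDeletion

/-! Two codewords with a common result lose bursts of the same length `t ≤ s`, starting at `i ≤ j`
after a possible swap. They agree outside `[i, j + t)`, and what lies between the bursts is shifted
by `t` (`IsBurstShift`). The constraints shrink this region until the codewords coincide.

Locate. By Abel summation (`VT_gaps_add`), the gap constraint fixes the sum of the positions of the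
pattern modulo `2n` once their number is known, and the number modulo 4 determines the number.
Suppose `j + t ≥ i + δ` and let `e` be the net number of occurrences that are carried from the left
end to the right end of the region. If `e > 0`, the sum changes by about `e (j - i)`, while the
shift of the occurrences in between contributes at most `(j - i) / 2` in the other direction. If `e
≤ 0`, the shift prevails over any opposing error at the ends, and density makes the change strict.
So the two sums differ by a nonzero amount below `2n`, a contradiction (`IsBurstShift.locate`).

First row. Each burst removes exactly one entry from the first row of the array with `t` rows. For
`t ≥ 2` the rank sums over adjacent blocks show that the two removed symbols are equal
(`entry_eq_of_mem_retrieve`); for `t = 1` this is automatic in a permutation. The shifted VT code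
makes the row signatures equal, and moving a symbol inside a sequence of distinct entries changes
the signature (`IsBurstShift.eq_of_mem_SVT`). Hence both bursts contain the same multiple of `t`,
the region is shorter than `2s`, and the rank of a pair of blocks of length `2s` determines it
(`eq_of_mem_recover`).

Redundancy. For large `n` a union bound shows that half of all permutations have a dense parity word
(`factorial_le_two_mul_card_dense`). There are `O(n (log n)^(3s-2))` relevant parameter choices, so
pigeonhole yields a large code (`exists_large_code`). Small `n` only need a nonempty code, provided
by an explicit dense permutation (`exists_dense`), and are absorbed in `K`. -/

namespace BurstDeletion

/-! ### Sequences that agree after a burst deletion -/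

/-- Deleting the `t` entries from position `i` on in `u` and from position `j` on in `v`, where
`i ≤ j`, leaves the same word; both words have length `n`. -/
structure IsBurstShift (t i j n : ℕ) (u v : ℕ → ℕ) : Prop where
  le : i ≤ j
  bound : j + t ≤ n
  left : ∀ m < i, u m = v m
  mid : ∀ m, i ≤ m → m < j → u (m + t) = v m
  right : ∀ m, j + t ≤ m → m < n → u m = v m

theorem IsBurstShift.comp {t i j n : ℕ} {u v : ℕ → ℕ} (h : IsBurstShift t i j n u v)
    (f : ℕ → ℕ) : IsBurstShift t i j n (fun m => f (u m)) (fun m => f (v m)) where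
  le := h.le
  bound := h.bound
  left m hm := by rw [h.left m hm]
  mid m h₁ h₂ := by rw [h.mid m h₁ h₂]
  right m h₁ h₂ := by rw [h.right m h₁ h₂]

/-- Restriction to a window that contains the region where the words differ. -/
theorem IsBurstShift.window {t i j n : ℕ} {u v : ℕ → ℕ} (h : IsBurstShift t i j n u v)
    {a b : ℕ} (ha : a ≤ i) (hb : j + t ≤ a + b) (hn : a + b ≤ n) :
    IsBurstShift t (i - a) (j - a) b (fun m => u (a + m)) (fun m => v (a + m)) where
  le := by have := h.le; omega
  bound := by have := h.le; omega
  left m hm := h.left _ (by omega)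
  mid m h₁ h₂ := by
    have := h.mid (a + m) (by omega) (by omega)
    rwa [add_assoc] at this
  right m h₁ h₂ := by
    have := h.le
    exact h.right _ (by omega) (by omega)

theorem IsBurstShift.sum_eq {t i j n : ℕ} {u v : ℕ → ℕ} (h : IsBurstShift t i j n u v) :
    ∑ m ∈ Finset.range n, u m + ∑ m ∈ Finset.Ico j (j + t), v m =
      ∑ m ∈ Finset.range n, v m + ∑ m ∈ Finset.Ico i (i + t), u m := by
  have hij := h.le
  have hn := h.bound
  have e₁ : ∑ m ∈ Finset.range n, u m = ∑ m ∈ Finset.range i, u m +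
      ∑ m ∈ Finset.Ico i (i + t), u m + ∑ m ∈ Finset.Ico (i + t) (j + t), u m +
      ∑ m ∈ Finset.Ico (j + t) n, u m := by
    rw [Finset.range_eq_Ico, Finset.range_eq_Ico, Finset.sum_Ico_consecutive _ (by omega) (by omega),
      Finset.sum_Ico_consecutive _ (by omega) (by omega),
      Finset.sum_Ico_consecutive _ (by omega) (by omega)]
  have e₂ : ∑ m ∈ Finset.range n, v m = ∑ m ∈ Finset.range i, v m +
      ∑ m ∈ Finset.Ico i j, v m + ∑ m ∈ Finset.Ico j (j + t), v m +
      ∑ m ∈ Finset.Ico (j + t) n, v m := by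
    rw [Finset.range_eq_Ico, Finset.range_eq_Ico, Finset.sum_Ico_consecutive _ (by omega) (by omega),
      Finset.sum_Ico_consecutive _ (by omega) (by omega),
      Finset.sum_Ico_consecutive _ (by omega) (by omega)]
  have f₁ : ∑ m ∈ Finset.range i, u m = ∑ m ∈ Finset.range i, v m :=
    Finset.sum_congr rfl fun m hm => h.left m (Finset.mem_range.1 hm)
  have f₂ : ∑ m ∈ Finset.Ico (j + t) n, u m = ∑ m ∈ Finset.Ico (j + t) n, v m :=
    Finset.sum_congr rfl fun m hm => h.right m (Finset.mem_Ico.1 hm).1 (Finset.mem_Ico.1 hm).2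
  have f₃ : ∑ m ∈ Finset.Ico (i + t) (j + t), u m = ∑ m ∈ Finset.Ico i j, v m := by
    rw [← Finset.sum_Ico_add']
    exact Finset.sum_congr rfl fun m hm =>
      h.mid m (Finset.mem_Ico.1 hm).1 (Finset.mem_Ico.1 hm).2
  omega

/-! ### Occurrences of the pattern `0^s 1^s` -/

/-- The pattern `0^s 1^s` occurs in the sequence `x` at position `q`. -/
def PatternAt (s : ℕ) (x : ℕ → ℕ) (q : ℕ) : Prop :=
  ∀ l < 2 * s, x (q + l) = if l < s then 0 else 1

instance (s : ℕ) (x : ℕ → ℕ) (q : ℕ) : Decidable (PatternAt s x q) :=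
  inferInstanceAs (Decidable (∀ l < 2 * s, x (q + l) = if l < s then 0 else 1))

/-- The positions at which `0^s 1^s` occurs in the first `n` entries of `x`. -/
def occurrences (s n : ℕ) (x : ℕ → ℕ) : Finset ℕ :=
  (Finset.range n).filter fun q => q + 2 * s ≤ n ∧ PatternAt s x q

theorem mem_occurrences {s n : ℕ} (hs : 1 ≤ s) {x : ℕ → ℕ} {q : ℕ} :
    q ∈ occurrences s n x ↔ q + 2 * s ≤ n ∧ PatternAt s x q := by
  simp only [occurrences, Finset.mem_filter, Finset.mem_range]
  constructor
  · exact fun h => h.2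
  · exact fun h => ⟨by omega, h⟩

theorem PatternAt.zero {s : ℕ} {x : ℕ → ℕ} {q : ℕ} (h : PatternAt s x q) {m : ℕ} (h₁ : q ≤ m)
    (h₂ : m < q + s) : x m = 0 := by
  have := h (m - q) (by omega)
  rwa [if_pos (by omega), show q + (m - q) = m by omega] at this

theorem PatternAt.one {s : ℕ} {x : ℕ → ℕ} {q : ℕ} (h : PatternAt s x q) {m : ℕ} (h₁ : q + s ≤ m)
    (h₂ : m < q + 2 * s) : x m = 1 := by
  have := h (m - q) (by omega)
  rwa [if_neg (by omega), show q + (m - q) = m by omega] at this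

/-- Distinct occurrences do not overlap. -/
theorem PatternAt.separated {s : ℕ} (hs : 1 ≤ s) {x : ℕ → ℕ} {q r : ℕ} (hq : PatternAt s x q)
    (hr : PatternAt s x r) (hqr : q < r) : q + 2 * s ≤ r := by
  by_contra hlt
  -- If the occurrences overlapped, this position would be both a one of `q` and a zero of `r`.
  have h₁ : x (max r (q + s)) = 1 := hq.one (by omega) (by omega)
  by_cases hc : q + s ≤ r
  · have := hr.zero (m := max r (q + s)) (by omega) (by omega)
    omega
  · have := hr.zero (m := max r (q + s)) (by omega) (by omega)
    omega

theorem PatternAt.congr {s : ℕ} {x y : ℕ → ℕ} {q r : ℕ} (h : PatternAt s x q)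
    (hxy : ∀ l < 2 * s, y (r + l) = x (q + l)) : PatternAt s y r :=
  fun l hl => (hxy l hl).trans (h l hl)

/-- A set of numbers in `[a, b)` with pairwise distances at least `L`. -/
theorem card_mul_le_of_separated {F : Finset ℕ} {a b L : ℕ} (hF : ∀ q ∈ F, a ≤ q ∧ q + L ≤ b)
    (hsep : ∀ q ∈ F, ∀ r ∈ F, q < r → q + L ≤ r) : F.card * L ≤ b - a := by
  have hdisj : (F : Set ℕ).PairwiseDisjoint fun q => Finset.Ico q (q + L) := by
    intro q hq r hr hqr
    rw [Function.onFun, Finset.disjoint_left]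
    intro m hm hm'
    rw [Finset.mem_Ico] at hm hm'
    rcases lt_or_gt_of_ne hqr with h | h
    · have := hsep q hq r hr h
      omega
    · have := hsep r hr q hq h
      omega
  have hcard := Finset.card_biUnion hdisj
  simp only [Nat.card_Ico, add_tsub_cancel_left, Finset.sum_const, smul_eq_mul] at hcard
  rw [← hcard, ← Nat.card_Ico]
  refine Finset.card_le_card fun m hm => ?_
  simp only [Finset.mem_biUnion, Finset.mem_Ico] at hm ⊢
  obtain ⟨q, hq, h⟩ := hm
  have := hF q hq
  omega

/-- Comparison of an occurrence `r` in `x` that a burst deletion at `i` destroys with an occurrence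
`q` that it creates in the resulting word `z`. -/
theorem PatternAt.created_bounds {s t i : ℕ} (ht : 1 ≤ t) (hts : t ≤ s) {x z : ℕ → ℕ} {q r : ℕ}
    (hr : PatternAt s x r) (hq : PatternAt s z q)
    (hleft : ∀ m, m < i → i ≤ m + 2 * s → z m = x m)
    (hright : ∀ m, i ≤ m → m < q + 2 * s → z m = x (m + t))
    (hri : r < i + t) (hir : i < r + 2 * s) (hqi : q < i) (hiq : i < q + 2 * s) :
    (q ≤ r ∨ q < r + t ∧ ∀ m ∈ Finset.Ico i (i + t), x m = 1) ∧
      (r ≤ q + t ∨ r = i ∧ r < q + 2 * t ∧ ∀ m ∈ Finset.Ico i (i + t), x m = 0) := by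
  have hst : ∀ m, i ≤ m → m < q + 2 * s → z m = x (m + t) := hright
  refine ⟨?_, ?_⟩
  · by_contra! hcon
    obtain ⟨hrq, hcon⟩ := hcon
    have h₁ : x q = 0 := by rw [← hleft q hqi (by omega)]; exact hq.zero le_rfl (by omega)
    have h₂ : q < r + s := by
      by_contra hc
      have := hr.one (m := q) (by omega) (by omega)
      omega
    have h₃ : i ≤ r + s := by
      by_contra hc
      have e₁ := hr.one (m := r + s) le_rfl (by omega)
      have e₂ := hq.zero (m := r + s) (by omega) (by omega)
      have e₃ := hleft (r + s) (by omega) (by omega)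
      omega
    -- Otherwise a one of `r` survives the deletion and lands in the zeros of `q`. So the burst is
    -- exactly the run of ones of `r`.
    have h₄ : t = s ∧ i = r + s := by
      by_contra hc
      have e₁ := hq.zero (m := max i (r + s - t)) (by omega) (by omega)
      have e₂ := hr.one (m := max i (r + s - t) + t) (by omega) (by omega)
      have e₃ := hst (max i (r + s - t)) (by omega) (by omega)
      omega
    obtain ⟨m, hm, hm'⟩ := hcon (by omega)
    rw [Finset.mem_Ico] at hm
    exact hm' (hr.one (by omega) (by omega))
  · by_contra! hcon
    obtain ⟨hrq, hcon⟩ := hcon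
    -- With `h₂` below, the zero run of `r` lies inside the burst; as `t ≤ s`, it is the whole
    -- burst.
    have h₁ : r + s ≤ i + t := by
      by_contra hc
      have e₁ := hq.one (m := max i (max (q + s) (r - t))) (by omega) (by omega)
      have e₂ := hr.zero (m := max i (max (q + s) (r - t)) + t) (by omega) (by omega)
      have e₃ := hst (max i (max (q + s) (r - t))) (by omega) (by omega)
      omega
    have h₂ : i ≤ r := by
      by_contra hc
      have e₁ := hq.one (m := max (q + s) r) (by omega) (by omega)
      have e₂ := hr.zero (m := max (q + s) r) (by omega) (by omega)
      have e₃ := hleft (max (q + s) r) (by omega) (by omega)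
      omega
    obtain ⟨m, hm, hm'⟩ := hcon (by omega) (by omega)
    rw [Finset.mem_Ico] at hm
    exact hm' (hr.zero (by omega) (by omega))

theorem sum_five_parts {F : Finset ℕ} (f : ℕ → ℕ) {p₁ p₂ p₃ p₄ p₅ : ℕ → Prop} [DecidablePred p₁]
    [DecidablePred p₂] [DecidablePred p₃] [DecidablePred p₄] [DecidablePred p₅]
    (h : ∀ q ∈ F, f q = (if p₁ q then f q else 0) + (if p₂ q then f q else 0) +
      (if p₃ q then f q else 0) + (if p₄ q then f q else 0) + (if p₅ q then f q else 0)) :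
    ∑ q ∈ F, f q = ∑ q ∈ F with p₁ q, f q + ∑ q ∈ F with p₂ q, f q + ∑ q ∈ F with p₃ q, f q +
      ∑ q ∈ F with p₄ q, f q + ∑ q ∈ F with p₅ q, f q := by
  simp only [Finset.sum_filter, ← Finset.sum_add_distrib]
  exact Finset.sum_congr rfl h

theorem card_le_two_cases {F : Finset ℕ} (h : F.card ≤ 2) :
    (F.card = 0 ∧ ∑ q ∈ F, q = 0 ∧ F = ∅) ∨ (∃ r ∈ F, F.card = 1 ∧ ∑ q ∈ F, q = r ∧ F = {r}) ∨
      ∃ r₁ ∈ F, ∃ r₂ ∈ F, F.card = 2 ∧ ∑ q ∈ F, q = r₁ + r₂ := by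
  have h' : F.card = 0 ∨ F.card = 1 ∨ F.card = 2 := by omega
  rcases h' with h' | h' | h'
  · rw [Finset.card_eq_zero] at h'
    subst h'
    simp
  · obtain ⟨r, rfl⟩ := Finset.card_eq_one.1 h'
    exact Or.inr (Or.inl ⟨r, by simp⟩)
  · obtain ⟨r₁, r₂, hr, rfl⟩ := Finset.card_eq_two.1 h'
    exact Or.inr (Or.inr ⟨r₁, by simp, r₂, by simp, h', Finset.sum_pair hr⟩)

/-- Two dense sequences with the same numbers of ones, as many occurrences of the pattern modulo
four, and the same sum of their positions modulo `2n`, that become equal by deleting a burst of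
length `t`: all differences lie in a window of length less than `δ`. -/
theorem IsBurstShift.locate {s t i j n δ : ℕ} {x y : ℕ → ℕ} (h : IsBurstShift t i j n x y)
    (hs : 1 ≤ s) (ht : 1 ≤ t) (hts : t ≤ s) (hδ : 32 * s ≤ δ) (hn : 2 * δ ≤ n)
    (hsum : ∑ m ∈ Finset.range n, x m = ∑ m ∈ Finset.range n, y m)
    (hx : ∀ a, a + δ ≤ n → ∃ q, a ≤ q ∧ q + 2 * s ≤ a + δ ∧ PatternAt s x q)
    (hy : ∀ a, a + δ ≤ n → ∃ q, a ≤ q ∧ q + 2 * s ≤ a + δ ∧ PatternAt s y q)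
    (hcard : (occurrences s n x).card ≡ (occurrences s n y).card [MOD 4])
    (hpos : (occurrences s n x).card = (occurrences s n y).card →
      ∑ q ∈ occurrences s n x, q ≡ ∑ q ∈ occurrences s n y, q [MOD 2 * n]) :
    j + t < i + δ := by
  by_contra! hcon
  have hb := h.bound
  set X := occurrences s n x with hX
  set Y := occurrences s n y with hY
  have memX : ∀ q, q ∈ X ↔ q + 2 * s ≤ n ∧ PatternAt s x q := fun q => mem_occurrences hs
  have memY : ∀ q, q ∈ Y ↔ q + 2 * s ≤ n ∧ PatternAt s y q := fun q => mem_occurrences hs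
  have sepX : ∀ q ∈ X, ∀ r ∈ X, q < r → q + 2 * s ≤ r := fun q hq r hr hqr =>
    PatternAt.separated hs ((memX q).1 hq).2 ((memX r).1 hr).2 hqr
  have sepY : ∀ q ∈ Y, ∀ r ∈ Y, q < r → q + 2 * s ≤ r := fun q hq r hr hqr =>
    PatternAt.separated hs ((memY q).1 hq).2 ((memY r).1 hr).2 hqr
  -- `A` and `B` are the occurrences destroyed by the deletions in `x` and in `y`. `C'` and `C` are
  -- those created in the common word at `i` and at `j`, seen in the other sequence. `M` and `M'`
  -- are the survivors in between, which move by `t`.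
  set A := X.filter fun q => i < q + 2 * s ∧ q < i + t with hA
  set C := X.filter fun q => j + t < q + 2 * s ∧ q < j + t with hC
  set C' := Y.filter fun q => i < q + 2 * s ∧ q < i with hC'
  set B := Y.filter fun q => j < q + 2 * s ∧ q < j + t with hB
  set M := X.filter fun q => i + t ≤ q ∧ q + 2 * s ≤ j + t with hM
  set M' := Y.filter fun q => i ≤ q ∧ q + 2 * s ≤ j with hM'
  have hLeft : (X.filter fun q => q + 2 * s ≤ i) = Y.filter fun q => q + 2 * s ≤ i := by
    ext q
    simp only [Finset.mem_filter, memX, memY]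
    constructor
    · rintro ⟨⟨h₁, h₂⟩, h₃⟩
      exact ⟨⟨h₁, h₂.congr fun l hl => (h.left _ (by omega)).symm⟩, h₃⟩
    · rintro ⟨⟨h₁, h₂⟩, h₃⟩
      exact ⟨⟨h₁, h₂.congr fun l hl => h.left _ (by omega)⟩, h₃⟩
  have hRight : (X.filter fun q => j + t ≤ q) = Y.filter fun q => j + t ≤ q := by
    ext q
    simp only [Finset.mem_filter, memX, memY]
    constructor
    · rintro ⟨⟨h₁, h₂⟩, h₃⟩
      exact ⟨⟨h₁, h₂.congr fun l hl => (h.right _ (by omega) (by omega)).symm⟩, h₃⟩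
    · rintro ⟨⟨h₁, h₂⟩, h₃⟩
      exact ⟨⟨h₁, h₂.congr fun l hl => h.right _ (by omega) (by omega)⟩, h₃⟩
  have hMid : M = M'.map (addRightEmbedding t) := by
    ext q
    simp only [hM, hM', Finset.mem_filter, Finset.mem_map, memX, memY, addRightEmbedding_apply]
    constructor
    · rintro ⟨⟨h₁, h₂⟩, h₃, h₄⟩
      refine ⟨q - t, ⟨⟨by omega, h₂.congr fun l hl => ?_⟩, by omega, by omega⟩, by omega⟩
      rw [← h.mid (q - t + l) (by omega) (by omega)]
      congr 1
      omega
    · rintro ⟨q, ⟨⟨h₁, h₂⟩, h₃, h₄⟩, rfl⟩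
      refine ⟨⟨by omega, h₂.congr fun l hl => ?_⟩, by omega, by omega⟩
      rw [← h.mid (q + l) (by omega) (by omega)]
      congr 1
      omega
  have hMcard : M.card = M'.card := by rw [hMid, Finset.card_map]
  have hMsum : ∑ q ∈ M, q = ∑ q ∈ M', q + M'.card * t := by
    rw [hMid, Finset.sum_map]
    simp [Finset.sum_add_distrib]
  have splitX : ∀ f : ℕ → ℕ, ∑ q ∈ X, f q = ∑ q ∈ X with q + 2 * s ≤ i, f q + ∑ q ∈ A, f q +
      ∑ q ∈ M, f q + ∑ q ∈ C, f q + ∑ q ∈ X with j + t ≤ q, f q := fun f =>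
    sum_five_parts f fun q _ => by split_ifs <;> omega
  have splitY : ∀ f : ℕ → ℕ, ∑ q ∈ Y, f q = ∑ q ∈ Y with q + 2 * s ≤ i, f q + ∑ q ∈ C', f q +
      ∑ q ∈ M', f q + ∑ q ∈ B, f q + ∑ q ∈ Y with j + t ≤ q, f q := fun f =>
    sum_five_parts f fun q _ => by split_ifs <;> omega
  have cardX := splitX fun _ => 1
  have cardY := splitY fun _ => 1
  have sumX := splitX fun q => q
  have sumY := splitY fun q => q
  simp only [← Finset.card_eq_sum_ones] at cardX cardY
  rw [hLeft, hRight] at cardX sumX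
  have memA : ∀ q ∈ A, q + 2 * s ≤ n ∧ PatternAt s x q ∧ i < q + 2 * s ∧ q < i + t := by
    intro q hq
    simpa [hA, memX, and_assoc] using hq
  have memC : ∀ q ∈ C, q + 2 * s ≤ n ∧ PatternAt s x q ∧ j + t < q + 2 * s ∧ q < j + t := by
    intro q hq
    simpa [hC, memX, and_assoc] using hq
  have memC' : ∀ q ∈ C', q + 2 * s ≤ n ∧ PatternAt s y q ∧ i < q + 2 * s ∧ q < i := by
    intro q hq
    simpa [hC', memY, and_assoc] using hq
  have memB : ∀ q ∈ B, q + 2 * s ≤ n ∧ PatternAt s y q ∧ j < q + 2 * s ∧ q < j + t := by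
    intro q hq
    simpa [hB, memY, and_assoc] using hq
  have cardA : A.card ≤ 2 := by
    have := card_mul_le_of_separated (F := A) (a := i + 1 - 2 * s) (b := i + t - 1 + 2 * s)
      (L := 2 * s) (fun q hq => by have := memA q hq; omega)
      (fun q hq r hr => sepX q (Finset.mem_of_mem_filter q hq) r (Finset.mem_of_mem_filter r hr))
    by_contra hc
    have : 3 * (2 * s) ≤ A.card * (2 * s) := Nat.mul_le_mul_right _ (by omega)
    omega
  have cardB : B.card ≤ 2 := by
    have := card_mul_le_of_separated (F := B) (a := j + 1 - 2 * s) (b := j + t - 1 + 2 * s)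
      (L := 2 * s) (fun q hq => by have := memB q hq; omega)
      (fun q hq r hr => sepY q (Finset.mem_of_mem_filter q hq) r (Finset.mem_of_mem_filter r hr))
    by_contra hc
    have : 3 * (2 * s) ≤ B.card * (2 * s) := Nat.mul_le_mul_right _ (by omega)
    omega
  have cardC : C.card ≤ 1 := by
    have := card_mul_le_of_separated (F := C) (a := j + t + 1 - 2 * s) (b := j + t - 1 + 2 * s)
      (L := 2 * s) (fun q hq => by have := memC q hq; omega)
      (fun q hq r hr => sepX q (Finset.mem_of_mem_filter q hq) r (Finset.mem_of_mem_filter r hr))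
    by_contra hc
    have : 2 * (2 * s) ≤ C.card * (2 * s) := Nat.mul_le_mul_right _ (by omega)
    omega
  have cardC' : C'.card ≤ 1 := by
    have := card_mul_le_of_separated (F := C') (a := i + 1 - 2 * s) (b := i - 1 + 2 * s)
      (L := 2 * s) (fun q hq => by have := memC' q hq; omega)
      (fun q hq r hr => sepY q (Finset.mem_of_mem_filter q hq) r (Finset.mem_of_mem_filter r hr))
    by_contra hc
    have : 2 * (2 * s) ≤ C'.card * (2 * s) := Nat.mul_le_mul_right _ (by omega)
    omega
  -- Survivors are at least `2 * s ≥ 2 * t` apart, so their total displacement is at most half the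
  -- length.
  have hT : 2 * (M'.card * t) ≤ j - i := by
    have := card_mul_le_of_separated (F := M') (a := i) (b := j) (L := 2 * s)
      (fun q hq => by simp only [hM', Finset.mem_filter] at hq; omega)
      (fun q hq r hr => sepY q (Finset.mem_of_mem_filter q hq) r (Finset.mem_of_mem_filter r hr))
    nlinarith [Nat.mul_le_mul_left M'.card hts]
  have hT' : M' = ∅ ∨ t ≤ M'.card * t := by
    rcases Finset.eq_empty_or_nonempty M' with h' | h'
    · exact Or.inl h'
    · exact Or.inr (Nat.le_mul_of_pos_left t h'.card_pos)
  generalize M'.card * t = T at hT hT' hMsum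
  -- The counts differ by `A + C - C' - B`, which is between -3 and 3; this is why modulus 4 is
  -- enough.
  have hN : X.card = Y.card := by
    unfold Nat.ModEq at hcard
    omega
  have hd : A.card + C.card = C'.card + B.card := by omega
  -- The exceptional alternatives of `left_bounds` and `right_bounds` exclude each other: `x` would
  -- lose `t` ones and `y` would lose `t` zeros, against `hsum`.
  have hbits : ¬ ((∀ m ∈ Finset.Ico i (i + t), x m = 1) ∧ ∀ m ∈ Finset.Ico j (j + t), y m = 0) := by
    rintro ⟨h₁, h₂⟩
    have := h.sum_eq
    rw [Finset.sum_congr rfl h₁, Finset.sum_congr rfl h₂, hsum] at this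
    simp at this
    omega
  have left_bounds : ∀ r ∈ A, ∀ q ∈ C',
      (q ≤ r ∨ q < r + t ∧ ∀ m ∈ Finset.Ico i (i + t), x m = 1) := by
    intro r hr q hq
    have hr := memA r hr
    have hq := memC' q hq
    exact (hr.2.1.created_bounds ht hts hq.2.1 (fun m h₁ h₂ => (h.left m h₁).symm)
      (fun m h₁ h₂ => (h.mid m h₁ (by omega)).symm) hr.2.2.2 hr.2.2.1 hq.2.2.2 hq.2.2.1).1
  have right_bounds : ∀ r ∈ B, ∀ q ∈ C,
      (r ≤ q ∨ r = j ∧ r < q + t ∧ ∀ m ∈ Finset.Ico j (j + t), y m = 0) := by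
    intro r hr q hq
    have hr := memB r hr
    have hq := memC q hq
    -- From `i` on, the common word is `x` shifted by `t`, so an occurrence at `q` in `x` is one at
    -- `q - t` there.
    have := (hr.2.1.created_bounds ht hts (z := fun m => x (m + t)) (q := q - t)
      (hq.2.1.congr fun l hl => by congr 1; omega) (fun m h₁ h₂ => h.mid m (by omega) h₁)
      (fun m h₁ h₂ => h.right (m + t) (by omega) (by omega)) hr.2.2.2 hr.2.2.1 (by omega)
      (by omega)).2
    rcases this with h' | ⟨h₁, h₂, h₃⟩
    · exact Or.inl (by omega)
    · exact Or.inr ⟨h₁, by omega, h₃⟩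
  -- The dense window of `x` starting at `i` ends by `j + t`. Without survivors, its occurrence must
  -- meet the burst. This supplies strictness when no occurrence is shifted.
  have emptyA : M' = ∅ → ∃ r ∈ A, i ≤ r := by
    intro he
    obtain ⟨q, h₁, h₂, h₃⟩ := hx i (by omega)
    have hqX : q ∈ X := (memX q).2 ⟨by omega, h₃⟩
    have hqM : q ∉ M := by rw [hMid, he]; simp
    simp only [hM, Finset.mem_filter, hqX, true_and] at hqM
    exact ⟨q, by simp only [hA, Finset.mem_filter, hqX, true_and]; omega, h₁⟩
  have emptyB : M' = ∅ → ∃ r ∈ B, r + 2 * s ≤ j + t := by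
    intro he
    obtain ⟨q, h₁, h₂, h₃⟩ := hy (j + t - δ) (by omega)
    have hqY : q ∈ Y := (memY q).2 ⟨by omega, h₃⟩
    have hqM : q ∉ M' := by rw [he]; simp
    simp only [hM', Finset.mem_filter, hqY, true_and] at hqM
    exact ⟨q, by simp only [hB, Finset.mem_filter, hqY, true_and]; omega, by omega⟩
  -- The cases are the sizes of `A`, `B`, `C`, `C'`, with `A - C' = B - C` by `hd`. If this
  -- difference is positive, `X` has the smaller sum; otherwise `Y` has.
  have key : ∑ q ∈ X, q ≠ ∑ q ∈ Y, q ∧ ∑ q ∈ X, q < ∑ q ∈ Y, q + 2 * n ∧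
      ∑ q ∈ Y, q < ∑ q ∈ X, q + 2 * n := by
    rcases card_le_two_cases cardA with ⟨a₁, a₂, a₃⟩ | ⟨r, hr, a₁, a₂, a₃⟩ | ⟨r, hr, r', hr', a₁, a₂⟩ <;>
    rcases card_le_two_cases cardB with ⟨b₁, b₂, b₃⟩ | ⟨p, hp, b₁, b₂, b₃⟩ | ⟨p, hp, p', hp', b₁, b₂⟩ <;>
    rcases card_le_two_cases (cardC.trans one_le_two) with
      ⟨c₁, c₂, -⟩ | ⟨c, hc, c₁, c₂, -⟩ | ⟨_, _, _, _, c₁, c₂⟩ <;>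
    rcases card_le_two_cases (cardC'.trans one_le_two) with
      ⟨d₁, d₂, -⟩ | ⟨d, hd', d₁, d₂, -⟩ | ⟨_, _, _, _, d₁, d₂⟩ <;>
    try omega
    · have hTt : t ≤ T := hT'.resolve_left fun he => by
        obtain ⟨r, hr, -⟩ := emptyA he
        simp [a₃] at hr
      omega
    · have hc := memC c hc
      have hd' := memC' d hd'
      omega
    · have hTt : t ≤ T := hT'.resolve_left fun he => by
        obtain ⟨r, hr, -⟩ := emptyA he
        simp [a₃] at hr
      have := right_bounds p hp c hc
      have hc := memC c hc
      omega
    · have hTt : t ≤ T := hT'.resolve_left fun he => by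
        obtain ⟨r, hr, -⟩ := emptyB he
        simp [b₃] at hr
      have := left_bounds r hr d hd'
      have hr := memA r hr
      have hd' := memC' d hd'
      omega
    · have hr := memA r hr
      have hp := memB p hp
      omega
    · have l := left_bounds r hr d hd'
      have rb := right_bounds p hp c hc
      have hr := memA r hr
      have hc := memC c hc
      have hd' := memC' d hd'
      have hp := memB p hp
      have hTt : t ≤ T ∨ i ≤ r ∧ p + 2 * s ≤ j + t := hT'.symm.imp_right fun he => by
        obtain ⟨r', hr', h₁⟩ := emptyA he
        obtain ⟨p', hp', h₂⟩ := emptyB he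
        rw [a₃, Finset.mem_singleton] at hr'
        rw [b₃, Finset.mem_singleton] at hp'
        omega
      rcases l with l | ⟨l, l'⟩ <;> rcases rb with rb | ⟨rb, rb', rb''⟩
      · omega
      · omega
      · omega
      · exact absurd ⟨l', rb''⟩ hbits
    · have hr := memA r hr
      have hp := memB p hp
      have hp' := memB p' hp'
      have hc := memC c hc
      omega
    · have hr := memA r hr
      have hr' := memA r' hr'
      have hp := memB p hp
      have hd' := memC' d hd'
      omega
    · have hr := memA r hr
      have hr' := memA r' hr'
      have hp := memB p hp
      have hp' := memB p' hp'
      omega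
    · have hr := memA r hr
      have hr' := memA r' hr'
      have hp := memB p hp
      have hp' := memB p' hp'
      have hc := memC c hc
      have hd' := memC' d hd'
      omega
  have hdvd := Nat.modEq_iff_dvd.1 (hpos hN)
  have := Int.eq_zero_of_abs_lt_dvd hdvd (by rw [abs_lt]; omega)
  omega

/-! ### The gap vector and the sum of the occurrence positions. -/

theorem sum_mul_gap_add_sum {f : ℕ → ℕ} {N : ℕ} (hf : ∀ i ≤ N, f i ≤ f (i + 1)) :
    ∑ i ∈ Finset.range (N + 1), (i + 1) * (f (i + 1) - f i) + ∑ i ∈ Finset.range (N + 1), f i =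
      (N + 1) * f (N + 1) := by
  induction N with
  | zero =>
    have := hf 0 le_rfl
    simp only [zero_add, Finset.range_one, Finset.sum_singleton, one_mul] at this ⊢
    omega
  | succ N ih =>
    have ih := ih fun i hi => hf i (by omega)
    rw [Finset.sum_range_succ _ (N + 1), Finset.sum_range_succ _ (N + 1)]
    have h := hf (N + 1) le_rfl
    obtain ⟨d, hd⟩ := Nat.exists_eq_add_of_le h
    rw [show N + 1 + 1 = N + 2 from rfl] at *
    rw [hd, Nat.add_sub_cancel_left]
    linarith

section Markers

variable {n m : ℕ} (p : Fin m → Fin 2) (x : Fin n → Fin 2)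

theorem sum_markers (g : ℕ → ℕ) : ((markers p x).map fun k : Fin (n + 2) => g k).sum =
    g 0 + ∑ i with indicator p x i = 1, g (i + 1) + g (n + 1) := by
  have h : ((markers p x).map fun k : Fin (n + 2) => g k).sum = ∑ k : Fin (n + 2),
      if (Fin.cons 1 (Fin.snoc (indicator p x) 1 : Fin (n + 1) → Fin 2) : Fin (n + 2) → Fin 2) k = 1
      then g k else 0 := by
    rw [← Finset.sum_filter, markers, ← List.sum_toFinset _ ((List.nodup_finRange _).filter _)]
    refine Finset.sum_congr ?_ fun _ _ => rfl
    ext k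
    simp
  rw [h, Fin.sum_univ_succ, Fin.sum_univ_castSucc, Finset.sum_filter]
  simp [add_assoc]

theorem length_markers : (markers p x).length = numOcc p x + 2 := by
  have h := sum_markers p x fun _ => 1
  simp only [List.map_const', List.sum_replicate, smul_eq_mul, mul_one] at h
  rw [h, numOcc, Finset.card_eq_sum_ones]
  omega

theorem markers_getD_last : ((markers p x).getD (numOcc p x + 1) 0 : ℕ) = n + 1 := by
  have hlen := length_markers p x
  obtain ⟨l, hl⟩ : ∃ l, markers p x = l ++ [Fin.last (n + 1)] := by
    rw [markers, List.finRange_succ_last, List.filter_append]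
    refine ⟨_, congrArg _ ?_⟩
    rw [List.filter_singleton, ← Fin.succ_last]
    simp
  rw [hl] at hlen ⊢
  have : numOcc p x + 1 = l.length := by
    simp at hlen
    omega
  simp [this]

theorem markers_getD_mono {i : ℕ} (hi : i ≤ numOcc p x) :
    ((markers p x).getD i 0 : ℕ) ≤ ((markers p x).getD (i + 1) 0 : ℕ) := by
  have hlen := length_markers p x
  rw [List.getD_eq_getElem _ _ (by omega), List.getD_eq_getElem _ _ (by omega)]
  have hs : (markers p x).Pairwise (· < ·) := (List.pairwise_lt_finRange _).filter _
  exact (List.pairwise_iff_getElem.1 hs i (i + 1) (by omega) (by omega) (by omega)).le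

/-- Abel summation over the markers, the last of which is at `n + 1`. The leading marker contributes
0 and moves every occurrence up by one. -/
theorem VT_gaps_add : VT (gaps p x) + ∑ i with indicator p x i = 1, ((i : ℕ) + 1) =
    (numOcc p x + 1) * (n + 1) := by
  have h := sum_mul_gap_add_sum (f := fun i => ((markers p x).getD i 0 : ℕ)) (N := numOcc p x)
    fun i hi => markers_getD_mono p x hi
  have hsum : ∑ i ∈ Finset.range (numOcc p x + 1), ((markers p x).getD i 0 : ℕ) =
      ∑ i with indicator p x i = 1, ((i : ℕ) + 1) := by
    have h₁ := sum_markers p x fun k => k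
    have h₂ : ((markers p x).map fun k : Fin (n + 2) => (k : ℕ)).sum =
        ∑ i ∈ Finset.range (numOcc p x + 2), ((markers p x).getD i 0 : ℕ) := by
      rw [← length_markers p x, Finset.sum_range, ← List.sum_ofFn]
      congr 1
      refine List.ext_getElem (by simp) fun i h₁ h₂ => ?_
      simp
    rw [h₂, Finset.sum_range_succ, markers_getD_last] at h₁
    omega
  rw [hsum, markers_getD_last] at h
  rw [← h, VT, Finset.sum_range]
  rfl

end Markers

/-- The parities of the entries of `u`, as an infinite sequence. -/
def paritySeq {n : ℕ} (u : Fin n → ℕ) (m : ℕ) : ℕ := entry u m % 2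

theorem occursAt_iff {s n : ℕ} (u : Fin n → ℕ) (i : ℕ) :
    OccursAt (pattern s) (parity u) i ↔ i + 2 * s ≤ n ∧ PatternAt s (paritySeq u) i := by
  unfold OccursAt PatternAt
  rw [← exists_prop]
  refine exists_congr fun h => ?_
  rw [Fin.forall_iff]
  refine forall₂_congr fun l hl => ?_
  simp only [parity, pattern, paritySeq, entry, show i + l < n by omega, dif_pos]
  split_ifs with h₁ h₂ <;> simp_all [Nat.odd_iff]

theorem sum_indicator {s n : ℕ} (u : Fin n → ℕ) (g : ℕ → ℕ) :
    ∑ i with indicator (pattern s) (parity u) i = 1, g i =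
      ∑ q ∈ occurrences s n (paritySeq u), g q := by
  rw [Finset.sum_filter, occurrences, Finset.sum_filter, Finset.sum_range]
  refine Finset.sum_congr rfl fun i _ => ?_
  simp [indicator, occursAt_iff]

theorem numOcc_eq {s n : ℕ} (u : Fin n → ℕ) :
    numOcc (pattern s) (parity u) = (occurrences s n (paritySeq u)).card := by
  rw [numOcc, Finset.card_eq_sum_ones, Finset.card_eq_sum_ones, sum_indicator u fun _ => 1]

theorem isDense_iff {s n δ : ℕ} (u : Fin n → ℕ) : IsDense (pattern s) δ (parity u) ↔
    ∀ a, a + δ ≤ n → ∃ q, a ≤ q ∧ q + 2 * s ≤ a + δ ∧ PatternAt s (paritySeq u) q := by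
  refine forall₂_congr fun a ha => exists_congr fun q => ?_
  rw [occursAt_iff]
  constructor
  · exact fun h => ⟨h.1, h.2.1, h.2.2.2⟩
  · exact fun h => ⟨h.1, h.2.1, by omega, h.2.2⟩

theorem locate_positions {s n : ℕ} {u v : Fin n → ℕ} {a₁ : ZMod 4} {a₂ : ZMod (2 * n)}
    (hu : parity u ∈ locate n s a₁ a₂) (hv : parity v ∈ locate n s a₁ a₂) :
    (occurrences s n (paritySeq u)).card ≡ (occurrences s n (paritySeq v)).card [MOD 4] ∧
    ((occurrences s n (paritySeq u)).card = (occurrences s n (paritySeq v)).card →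
      ∑ q ∈ occurrences s n (paritySeq u), q ≡ ∑ q ∈ occurrences s n (paritySeq v), q
        [MOD 2 * n]) := by
  obtain ⟨-, hu₁, hu₂⟩ := hu
  obtain ⟨-, hv₁, hv₂⟩ := hv
  have h₁ := (ZMod.natCast_eq_natCast_iff _ _ _).1 (hu₁.trans hv₁.symm)
  have h₂ := (ZMod.natCast_eq_natCast_iff _ _ _).1 (hu₂.trans hv₂.symm)
  have gu := VT_gaps_add (pattern s) (parity u)
  have gv := VT_gaps_add (pattern s) (parity v)
  rw [sum_indicator u fun i => i + 1] at gu
  rw [sum_indicator v fun i => i + 1] at gv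
  rw [numOcc_eq, numOcc_eq] at h₁
  replace gu := gu.trans (by rw [numOcc_eq])
  replace gv := gv.trans (by rw [numOcc_eq])
  refine ⟨h₁, fun hc => ?_⟩
  rw [hc, ← gv] at gu
  have h₃ := h₂.add_left_cancel (c := ∑ q ∈ occurrences s n (paritySeq u), (q + 1))
    (d := ∑ q ∈ occurrences s n (paritySeq v), (q + 1)) (by rw [gu])
  simp only [Finset.sum_add_distrib, ← Finset.card_eq_sum_ones, hc] at h₃
  exact Nat.ModEq.add_right_cancel' _ h₃

/-! ### Shifted Varshamov–Tenengolts constraints on signatures -/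

/-- Each shifted entry stands one place further right in `x` than in `y`, so it is counted once
more; this is the last sum. -/
theorem IsBurstShift.weighted_sum_eq {f g m : ℕ} {x y : ℕ → ℕ} (h : IsBurstShift 1 f g m x y) :
    ∑ l ∈ Finset.range m, (l + 1) * x l + (g + 1) * y g =
      ∑ l ∈ Finset.range m, (l + 1) * y l + (f + 1) * x f + ∑ l ∈ Finset.Ico f g, y l := by
  have hfg := h.le
  have hm := h.bound
  have e₁ : ∑ l ∈ Finset.range m, (l + 1) * x l = ∑ l ∈ Finset.range f, (l + 1) * x l +
      (f + 1) * x f + ∑ l ∈ Finset.Ico (f + 1) (g + 1), (l + 1) * x l +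
      ∑ l ∈ Finset.Ico (g + 1) m, (l + 1) * x l := by
    rw [← Finset.sum_range_succ, Finset.range_eq_Ico, Finset.range_eq_Ico,
      Finset.sum_Ico_consecutive _ (by omega) (by omega),
      Finset.sum_Ico_consecutive _ (by omega) (by omega)]
  have e₂ : ∑ l ∈ Finset.range m, (l + 1) * y l = ∑ l ∈ Finset.range f, (l + 1) * y l +
      ∑ l ∈ Finset.Ico f g, (l + 1) * y l + (g + 1) * y g +
      ∑ l ∈ Finset.Ico (g + 1) m, (l + 1) * y l := by
    rw [Finset.range_eq_Ico, Finset.range_eq_Ico, Finset.sum_Ico_consecutive _ (by omega) (by omega),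
      ← Finset.sum_Ico_succ_top (by omega), Finset.sum_Ico_consecutive _ (by omega) (by omega)]
  have f₁ : ∑ l ∈ Finset.range f, (l + 1) * x l = ∑ l ∈ Finset.range f, (l + 1) * y l :=
    Finset.sum_congr rfl fun l hl => by rw [h.left l (Finset.mem_range.1 hl)]
  have f₂ : ∑ l ∈ Finset.Ico (g + 1) m, (l + 1) * x l = ∑ l ∈ Finset.Ico (g + 1) m, (l + 1) * y l :=
    Finset.sum_congr rfl fun l hl => by
      rw [h.right l (Finset.mem_Ico.1 hl).1 (Finset.mem_Ico.1 hl).2]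
  have f₃ : ∑ l ∈ Finset.Ico (f + 1) (g + 1), (l + 1) * x l =
      ∑ l ∈ Finset.Ico f g, (l + 1) * y l + ∑ l ∈ Finset.Ico f g, y l := by
    rw [← Finset.sum_Ico_add', ← Finset.sum_add_distrib]
    refine Finset.sum_congr rfl fun l hl => ?_
    rw [h.mid l (Finset.mem_Ico.1 hl).1 (Finset.mem_Ico.1 hl).2]
    ring
  omega

/-- The binary shifted VT code corrects a deletion whose position is known up to `P`. -/
theorem IsBurstShift.eq_of_shiftedVT {f g m P : ℕ} {x y : ℕ → ℕ} (h : IsBurstShift 1 f g m x y)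
    (hx : ∀ l, x l ≤ 1) (hy : ∀ l, y l ≤ 1) (hP : g < f + P)
    (hVT : ∑ l ∈ Finset.range m, (l + 1) * x l ≡ ∑ l ∈ Finset.range m, (l + 1) * y l [MOD P])
    (hsum : ∑ l ∈ Finset.range m, x l ≡ ∑ l ∈ Finset.range m, y l [MOD 2]) :
    ∀ l < m, x l = y l := by
  have hfg := h.le
  have hse := h.sum_eq
  simp only [Nat.Ico_succ_singleton, Finset.sum_singleton] at hse
  -- The sums differ by the deleted bits only, so parity identifies them.
  have he : y g = x f := by
    have := hx f
    have := hy g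
    unfold Nat.ModEq at hsum
    omega
  have hw := h.weighted_sum_eq
  have hle : ∑ l ∈ Finset.Ico f g, y l ≤ g - f := by
    simpa using Finset.sum_le_card_nsmul (Finset.Ico f g) y 1 fun l _ => hy l
  -- Both sides lie between 0 and `g - f < P`, so the congruence is an equality. It forces `y` to be
  -- constantly `x f` on `[f, g)`: both deletions occur in one run.
  have key : (g - f) * x f = ∑ l ∈ Finset.Ico f g, y l := by
    have h₁ : (g - f) * x f ≤ g - f := by
      simpa using Nat.mul_le_mul_left (g - f) (hx f)
    have h₂ : ∑ l ∈ Finset.range m, (l + 1) * x l + (g - f) * x f =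
        ∑ l ∈ Finset.range m, (l + 1) * y l + ∑ l ∈ Finset.Ico f g, y l := by
      rw [he] at hw
      have : (g + 1) * x f = (g - f) * x f + (f + 1) * x f := by
        rw [← add_mul]
        congr 1
        omega
      omega
    have h₃ : (g - f) * x f ≡ ∑ l ∈ Finset.Ico f g, y l [MOD P] := by
      refine hVT.add_left_cancel ?_
      rw [h₂]
    exact Nat.ModEq.eq_of_lt_of_lt h₃ (by omega) (by omega)
  have hconst : ∀ l, f ≤ l → l < g → y l = x f := by
    intro l h₁ h₂
    have hl : l ∈ Finset.Ico f g := Finset.mem_Ico.2 ⟨h₁, h₂⟩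
    rcases Nat.le_one_iff_eq_zero_or_eq_one.1 (hx f) with h0 | h0
    · rw [h0, mul_zero] at key
      rw [h0]
      exact (Finset.sum_eq_zero_iff.1 key.symm) l hl
    · rw [h0, mul_one] at key
      rw [h0]
      have := (Finset.sum_eq_sum_iff_of_le (s := Finset.Ico f g) (f := y) (g := fun _ => 1)
        fun l _ => hy l).1 (by simp [← key])
      exact this l hl
  intro l hl
  rcases lt_or_ge l f with h₁ | h₁
  · exact h.left l h₁
  rcases lt_or_ge g l with h₂ | h₂
  · exact h.right l h₂ hl
  have hyl : y l = x f := by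
    rcases h₂.eq_or_lt with h₃ | h₃
    · rw [h₃, he]
    · exact hconst l h₁ h₃
  rw [hyl]
  rcases h₁.eq_or_lt with h₃ | h₃
  · rw [h₃]
  · have := h.mid (l - 1) (by omega) (by omega)
    rw [show l - 1 + 1 = l by omega] at this
    rw [this, hconst (l - 1) (by omega) (by omega)]

/-- The signature of an infinite sequence. -/
def ascents (w : ℕ → ℕ) (l : ℕ) : ℕ := if w l ≤ w (l + 1) then 1 else 0

/-- Deleting an entry from a sequence deletes an entry from its signature. -/
theorem IsBurstShift.exists_ascents {i j N : ℕ} {u v : ℕ → ℕ} (h : IsBurstShift 1 i j N u v)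
    (hij : i < j) : ∃ f g, g ≤ f + (j - i + 1) ∧
      IsBurstShift 1 f g (N - 1) (ascents u) (ascents v) := by
  have hb := h.bound
  -- Removing entry `i` merges two comparisons into one, which by transitivity equals one of the
  -- two. The other one counts as deleted, so `f` is `i` or `i - 1`.
  obtain ⟨f, hf, hf', hfl, hfr⟩ : ∃ f, f ≤ i ∧ i ≤ f + 1 ∧
      (∀ l < f, ascents u l = ascents v l) ∧
      (∀ l, f ≤ l → l < i → ascents u (l + 1) = ascents v l) := by
    rcases Nat.eq_zero_or_pos i with h0 | h0
    · subst h0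
      exact ⟨0, le_rfl, by omega, fun l hl => by omega, fun l _ hl => by omega⟩
    have e₁ := h.left (i - 1) (by omega)
    have e₂ := h.mid i le_rfl hij
    have hlow : ∀ l < i - 1, ascents u l = ascents v l := by
      intro l hl
      simp only [ascents, h.left l (by omega), h.left (l + 1) (by omega)]
    by_cases hc : ascents u (i - 1) = ascents v (i - 1)
    · refine ⟨i, le_rfl, by omega, fun l hl => ?_, fun l _ hl => by omega⟩
      rcases eq_or_ne l (i - 1) with rfl | hne
      · exact hc
      · exact hlow l (by omega)
    · refine ⟨i - 1, by omega, by omega, hlow, fun l h₁ h₂ => ?_⟩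
      obtain rfl : l = i - 1 := by omega
      simp only [ascents, show i - 1 + 1 = i by omega, e₁, e₂] at hc ⊢
      split_ifs at hc ⊢ <;> first | rfl | (exfalso; omega)
  obtain ⟨g, hg, hg', hgb, hgl, hgr⟩ : ∃ g, g ≤ j ∧ j ≤ g + 1 ∧ g + 1 ≤ N - 1 ∧
      (∀ l, j ≤ l + 1 → l < g → ascents u (l + 1) = ascents v l) ∧
      (∀ l, g + 1 ≤ l → l < N - 1 → ascents u l = ascents v l) := by
    have hhigh : ∀ l, j + 1 ≤ l → l < N - 1 →
        ascents u l = ascents v l := by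
      intro l h₁ h₂
      simp only [ascents, h.right l (by omega) (by omega),
        h.right (l + 1) (by omega) (by omega)]
    rcases eq_or_lt_of_le hb with hN | hN
    · exact ⟨j - 1, by omega, by omega, by omega, fun l _ _ => by omega, fun l _ _ => by omega⟩
    have e₁ := h.right (j + 1) le_rfl hN
    have e₂ := h.mid (j - 1) (by omega) (by omega)
    rw [show j - 1 + 1 = j by omega] at e₂
    by_cases hc : ascents u j = ascents v j
    · refine ⟨j - 1, by omega, by omega, by omega, fun l _ _ => by omega, fun l h₁ h₂ => ?_⟩
      rcases eq_or_ne l j with rfl | hne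
      · exact hc
      · exact hhigh l (by omega) h₂
    · refine ⟨j, by omega, by omega, by omega, fun l h₁ h₂ => ?_, hhigh⟩
      obtain rfl : l = j - 1 := by omega
      simp only [ascents, show j - 1 + 1 = j by omega, e₁, e₂] at hc ⊢
      split_ifs at hc ⊢ <;> first | rfl | (exfalso; omega)
  refine ⟨f, g, by omega, by omega, hgb, hfl, fun l h₁ h₂ => ?_, hgr⟩
  rcases lt_or_ge l i with h₃ | h₃
  · exact hfr l h₁ h₃
  rcases lt_or_ge (l + 1) j with h₄ | h₄
  · simp only [ascents, h.mid l h₃ (by omega), h.mid (l + 1) (by omega) h₄]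
  · exact hgl l h₄ h₂

/-- Sequences with distinct entries and the same signature cannot arise from each other by moving
one entry. -/
theorem IsBurstShift.eq_of_ascents_eq {i j N : ℕ} {u v : ℕ → ℕ} (h : IsBurstShift 1 i j N u v)
    (hu : ∀ l < N, ∀ m < N, u l = u m → l = m) (huv : u i = v j)
    (hasc : ∀ l < N - 1, ascents u l = ascents v l) : i = j := by
  by_contra hne
  have hij : i < j := lt_of_le_of_ne h.le hne
  have hb := h.bound
  have hstep : ∀ l, i ≤ l → l < j → ascents u l = ascents u i := by
    intro l hl
    induction l, hl using Nat.le_induction with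
    | base => exact fun _ => rfl
    | succ l hl ih =>
      intro hlj
      rw [← ih (by omega), hasc l (by omega)]
      simp only [ascents, h.mid l hl (by omega), h.mid (l + 1) (by omega) hlj]
  have hlast : ascents v (j - 1) = ascents u i := by
    rw [← hasc _ (by omega), hstep _ (by omega) (by omega)]
  have e := h.mid (j - 1) (by omega) (by omega)
  rw [show j - 1 + 1 = j by omega] at e
  -- The comparison of `u j` with the moved symbol `u i` closes a cycle: `u i, …, u j, u i` would be
  -- all ascents or all descents.
  have hlast' : (if u j ≤ u i then 1 else 0) = ascents u i := by
    rw [← hlast, ascents, show j - 1 + 1 = j by omega, e, huv]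
  by_cases hc : u i ≤ u (i + 1)
  · have hone : ascents u i = 1 := if_pos hc
    have hmono : ∀ l, i ≤ l → l ≤ j → u i ≤ u l := by
      intro l hl
      induction l, hl using Nat.le_induction with
      | base => exact fun _ => le_rfl
      | succ l hl ih =>
        intro hlj
        refine (ih (by omega)).trans ?_
        by_contra hcon
        have := hstep l hl (by omega)
        rw [hone, ascents, if_neg hcon] at this
        omega
    have h₁ := hmono j (by omega) le_rfl
    have h₂ : u j ≤ u i := by
      by_contra hcon
      rw [hone, if_neg hcon] at hlast'
      omega
    exact hne (hu i (by omega) j (by omega) (le_antisymm h₁ h₂))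
  · have hzero : ascents u i = 0 := if_neg hc
    have hmono : ∀ l, i ≤ l → l ≤ j → u l ≤ u i := by
      intro l hl
      induction l, hl using Nat.le_induction with
      | base => exact fun _ => le_rfl
      | succ l hl ih =>
        intro hlj
        refine le_trans ?_ (ih (by omega))
        by_contra hcon
        have := hstep l hl (by omega)
        rw [hzero, ascents, if_pos (by omega)] at this
        omega
    have h₁ := hmono j (by omega) le_rfl
    rw [hzero, if_pos h₁] at hlast'
    omega

theorem coe_signature {N : ℕ} (w : Fin N → ℕ) (l : Fin (N - 1)) :
    ((signature w l : Fin 2) : ℕ) = ascents (entry w) l := by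
  have h₁ : (l : ℕ) < N := by omega
  have h₂ : (l : ℕ) + 1 < N := by omega
  simp only [signature, ascents, entry, dif_pos h₁, dif_pos h₂]
  split_ifs <;> rfl

theorem IsBurstShift.eq_of_mem_SVT {i j N P : ℕ} {w w' : Fin N → ℕ}
    (h : IsBurstShift 1 i j N (entry w) (entry w')) (hw : Function.Injective w)
    (hww' : entry w i = entry w' j) (hP : j + 2 ≤ i + P) {b₁ : ZMod P} {b₂ : ZMod 2}
    (hb : signature w ∈ SVT (N - 1) P b₁ b₂) (hb' : signature w' ∈ SVT (N - 1) P b₁ b₂) :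
    i = j := by
  by_contra hne
  have hij : i < j := lt_of_le_of_ne h.le hne
  obtain ⟨f, g, hfg, hshift⟩ := h.exists_ascents hij
  have h₁ := (ZMod.natCast_eq_natCast_iff _ _ _).1 (hb.1.trans hb'.1.symm)
  have h₂ := (ZMod.natCast_eq_natCast_iff _ _ _).1 (hb.2.trans hb'.2.symm)
  simp only [VT, coe_signature] at h₁ h₂
  rw [Fin.sum_univ_eq_sum_range (fun l => (l + 1) * ascents (entry w) l),
    Fin.sum_univ_eq_sum_range (fun l => (l + 1) * ascents (entry w') l)] at h₁
  rw [Fin.sum_univ_eq_sum_range (fun l => ascents (entry w) l),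
    Fin.sum_univ_eq_sum_range (fun l => ascents (entry w') l)] at h₂
  have hle : ∀ (w : ℕ → ℕ) l, ascents w l ≤ 1 := fun w l => by
    unfold ascents
    split_ifs <;> omega
  refine hne (h.eq_of_ascents_eq (fun l hl m hm hlm => ?_) hww'
    (hshift.eq_of_shiftedVT (hle _) (hle _) (by omega) h₁ h₂))
  simp only [entry, dif_pos hl, dif_pos hm] at hlm
  exact congrArg Fin.val (hw hlm)

/-! ### Projections and ranks -/

/-- The rank of `r` in a finite set of numbers, counted from one. -/
def rankIn (R : Finset ℕ) (r : ℕ) : ℕ := (R.filter (· < r)).card + 1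

theorem rankIn_lt_rankIn {R : Finset ℕ} {a b : ℕ} (ha : a ∈ R) (hab : a < b) :
    rankIn R a < rankIn R b := by
  refine Nat.add_lt_add_right (Finset.card_lt_card ?_) 1
  rw [Finset.ssubset_iff_of_subset]
  · exact ⟨a, by simp [ha, hab]⟩
  · intro r hr
    rw [Finset.mem_filter] at hr ⊢
    exact ⟨hr.1, hr.2.trans hab⟩

theorem rankIn_injOn {R : Finset ℕ} {a b : ℕ} (ha : a ∈ R) (hb : b ∈ R)
    (h : rankIn R a = rankIn R b) : a = b := by
  rcases lt_trichotomy a b with hab | hab | hab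
  · exact absurd h (rankIn_lt_rankIn ha hab).ne
  · exact hab
  · exact absurd h (rankIn_lt_rankIn hb hab).ne'

theorem rankIn_le_card {R : Finset ℕ} {a : ℕ} (ha : a ∈ R) : rankIn R a ≤ R.card := by
  refine Nat.succ_le_of_lt (Finset.card_lt_card ?_)
  rw [Finset.filter_ssubset]
  exact ⟨a, ha, lt_irrefl a⟩

theorem projection_eq_rankIn {m : ℕ} {u : Fin m → ℕ} (hu : Function.Injective u) (i : Fin m) :
    projection u i = rankIn (Finset.univ.image u) (u i) := by
  have h₁ : (Finset.univ.filter fun j => u j = u i ∧ j ≤ i) = {i} := by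
    ext j
    simp only [Finset.mem_filter, Finset.mem_univ, true_and, Finset.mem_singleton]
    exact ⟨fun h => hu h.1, fun h => by simp [h]⟩
  rw [projection, h₁, rankIn, Finset.filter_image, Finset.card_image_of_injective _ hu,
    Finset.card_singleton]

theorem eq_of_projection_eq {m : ℕ} {u v : Fin m → ℕ} (hu : Function.Injective u)
    (hv : Function.Injective v) (huv : Finset.univ.image u = Finset.univ.image v)
    (h : projection u = projection v) : u = v := by
  funext i
  have hi := congrFun h i
  rw [projection_eq_rankIn hu, projection_eq_rankIn hv, ← huv] at hi
  refine rankIn_injOn (Finset.mem_image_of_mem _ (Finset.mem_univ _)) ?_ hi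
  rw [huv]
  exact Finset.mem_image_of_mem _ (Finset.mem_univ _)

theorem exists_permVec_eq_projection {m : ℕ} {u : Fin m → ℕ} (hu : Function.Injective u) :
    ∃ π : Equiv.Perm (Fin m), permVec π = projection u := by
  have hmem : ∀ i, u i ∈ Finset.univ.image u := fun i =>
    Finset.mem_image_of_mem _ (Finset.mem_univ _)
  have hpos : ∀ i, 1 ≤ projection u i := fun i => by
    rw [projection_eq_rankIn hu, rankIn]
    omega
  have hle : ∀ i, projection u i ≤ m := fun i => by
    rw [projection_eq_rankIn hu]
    refine (rankIn_le_card (hmem i)).trans ?_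
    simpa using Finset.card_image_le (s := Finset.univ) (f := u)
  let f : Fin m → Fin m := fun i => ⟨projection u i - 1, by have := hpos i; have := hle i; omega⟩
  have hf : Function.Injective f := by
    intro i j hij
    have hij := congrArg Fin.val hij
    simp only [f] at hij
    have h := hpos i
    have h' := hpos j
    refine hu (rankIn_injOn (hmem i) (hmem j) ?_)
    rw [← projection_eq_rankIn hu, ← projection_eq_rankIn hu]
    omega
  refine ⟨Equiv.ofBijective f (Finite.injective_iff_bijective.1 hf), funext fun i => ?_⟩
  simp only [permVec, Equiv.ofBijective_apply, f]
  have := hpos i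
  omega

theorem permVec_injective_vec {m : ℕ} (π : Equiv.Perm (Fin m)) : Function.Injective (permVec π) :=
  fun i j h => π.injective (Fin.ext (by simpa [permVec] using h))

theorem permVec_injective {m : ℕ} {π ρ : Equiv.Perm (Fin m)} (h : permVec π = permVec ρ) :
    π = ρ :=
  Equiv.ext fun i => Fin.ext (by simpa [permVec] using congrFun h i)

theorem lexRank_eq {m : ℕ} (v : Fin m → ℕ) : lexRank v =
    (Finset.univ.filter fun π : Equiv.Perm (Fin m) => toLex (permVec π) ≤ toLex v).card := by
  unfold lexRank
  congr 1
  ext π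
  simp only [Finset.mem_filter, Finset.mem_univ, true_and]
  rw [le_iff_lt_or_eq, or_comm]
  exact or_congr Iff.rfl toLex_inj.symm

theorem lexRank_pos {m : ℕ} (π : Equiv.Perm (Fin m)) : 1 ≤ lexRank (permVec π) := by
  rw [lexRank_eq]
  exact Finset.card_pos.2 ⟨π, by simp⟩

theorem lexRank_le {m : ℕ} (v : Fin m → ℕ) : lexRank v ≤ m.factorial := by
  rw [lexRank_eq]
  refine Finset.card_le_univ _ |>.trans ?_
  rw [Fintype.card_perm, Fintype.card_fin]

theorem lexRank_injective {m : ℕ} {π ρ : Equiv.Perm (Fin m)}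
    (h : lexRank (permVec π) = lexRank (permVec ρ)) : π = ρ := by
  wlog hle : toLex (permVec π) ≤ toLex (permVec ρ) generalizing π ρ
  · exact (this h.symm (le_of_not_ge hle)).symm
  rw [lexRank_eq, lexRank_eq] at h
  have hsub := Finset.eq_of_subset_of_card_le (s := Finset.univ.filter
    fun κ : Equiv.Perm (Fin m) => toLex (permVec κ) ≤ toLex (permVec π))
    (t := Finset.univ.filter fun κ : Equiv.Perm (Fin m) => toLex (permVec κ) ≤ toLex (permVec ρ))
    (fun κ hκ => by
      rw [Finset.mem_filter] at hκ ⊢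
      exact ⟨hκ.1, hκ.2.trans hle⟩) h.ge
  have hρ : ρ ∈ Finset.univ.filter
      fun κ : Equiv.Perm (Fin m) => toLex (permVec κ) ≤ toLex (permVec π) := by
    rw [hsub]
    simp
  rw [Finset.mem_filter] at hρ
  exact permVec_injective (toLex_inj.1 (le_antisymm hle hρ.2))

theorem eq_of_modEq_of_pos {a b M : ℕ} (h : a ≡ b [MOD M]) (ha : 1 ≤ a) (ha' : a ≤ M) (hb : 1 ≤ b)
    (hb' : b ≤ M) : a = b := by
  have h' : (a - 1) ≡ (b - 1) [MOD M] := by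
    refine Nat.ModEq.add_right_cancel' 1 ?_
    rwa [Nat.sub_add_cancel ha, Nat.sub_add_cancel hb]
  have := h'.eq_of_lt_of_lt (by omega) (by omega)
  omega

/-- Ranks lie in `1, …, m!`, so reduction modulo `m!` loses nothing. The rank gives the order
pattern, and the common symbol set then gives the vector. -/
theorem eq_of_permRank_modEq {m : ℕ} {u v : Fin m → ℕ} (hu : Function.Injective u)
    (hv : Function.Injective v) (huv : Finset.univ.image u = Finset.univ.image v)
    (h : permRank u ≡ permRank v [MOD m.factorial]) : u = v := by
  obtain ⟨π, hπ⟩ := exists_permVec_eq_projection hu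
  obtain ⟨ρ, hρ⟩ := exists_permVec_eq_projection hv
  refine eq_of_projection_eq hu hv huv ?_
  unfold permRank at h
  rw [← hπ, ← hρ] at h ⊢
  rw [lexRank_injective (eq_of_modEq_of_pos h (lexRank_pos _) (lexRank_le _) (lexRank_pos _)
    (lexRank_le _))]

/-! ### Pairs of consecutive blocks -/

theorem blockPair_apply {n L m : ℕ} (u : Fin n → ℕ) (hm : m + 1 < n / L) (j : Fin (L + L)) :
    blockPair L u m j = entry u (m * L + j) := by
  unfold blockPair
  rw [Nat.mod_eq_of_lt hm]
  refine Fin.addCases (fun i => ?_) (fun i => ?_) j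
  · rw [Fin.append_left]
    rfl
  · rw [Fin.append_right, block, Fin.val_natAdd]
    congr 1
    ring

theorem block_congr {n L m k : ℕ} {u v : Fin n → ℕ}
    (h : ∀ l, l < m * L ∨ (m + 2) * L ≤ l → entry u l = entry v l) (hk : k ≠ m) (hk' : k ≠ m + 1) :
    block L u k = block L v k := by
  funext j
  have hj := j.isLt
  refine h _ ?_
  rcases lt_or_gt_of_ne hk with hlt | hlt
  · left
    have := Nat.mul_le_mul_right L (Nat.succ_le_of_lt hlt)
    rw [Nat.succ_eq_add_one, add_mul] at this
    omega
  · right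
    have := Nat.mul_le_mul_right L (show m + 2 ≤ k by omega)
    omega

/-- If two words differ only in the blocks `m` and `m + 1`, congruent sums over all pairs of blocks
of either parity give a congruence for the pair `(m, m + 1)`. -/
theorem blockPair_modEq {n L K Q m : ℕ} (hL : 0 < L) (hn : n = L * (2 * K)) (hm : m + 1 < 2 * K)
    {u v : Fin n → ℕ} (h : ∀ l, l < m * L ∨ (m + 2) * L ≤ l → entry u l = entry v l)
    (f : (Fin (L + L) → ℕ) → ℕ)
    (h₀ : ∑ i ∈ Finset.range K, f (blockPair L u (2 * i)) ≡
      ∑ i ∈ Finset.range K, f (blockPair L v (2 * i)) [MOD Q])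
    (h₁ : ∑ i ∈ Finset.range K, f (blockPair L u (2 * i + 1)) ≡
      ∑ i ∈ Finset.range K, f (blockPair L v (2 * i + 1)) [MOD Q]) :
    f (blockPair L u m) ≡ f (blockPair L v m) [MOD Q] := by
  have hdiv : n / L = 2 * K := by rw [hn, Nat.mul_div_cancel_left _ hL]
  have hpair : ∀ k, k < 2 * K → k % 2 = m % 2 → k ≠ m → blockPair L u k = blockPair L v k := by
    intro k hk hkm hne
    -- The number of blocks is even, so even after wrapping around, the second block has the parity
    -- of `k + 1` and cannot be `m`.
    have hmod : (k + 1) % (2 * K) ≠ m ∧ (k + 1) % (2 * K) ≠ m + 1 := by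
      rcases lt_or_ge (k + 1) (2 * K) with hlt | hge
      · rw [Nat.mod_eq_of_lt hlt]
        omega
      · rw [show k + 1 = 2 * K by omega, Nat.mod_self]
        omega
    unfold blockPair
    rw [hdiv, block_congr h hne (by omega), block_congr h hmod.1 hmod.2]
  obtain ⟨e, he | he⟩ := Nat.even_or_odd' m
  · have heK : e ∈ Finset.range K := Finset.mem_range.2 (by omega)
    have hrest : ∑ i ∈ (Finset.range K).erase e, f (blockPair L u (2 * i)) =
        ∑ i ∈ (Finset.range K).erase e, f (blockPair L v (2 * i)) :=
      Finset.sum_congr rfl fun i hi => by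
        rw [Finset.mem_erase, Finset.mem_range] at hi
        rw [hpair (2 * i) (by omega) (by omega) (by omega)]
    rw [← Finset.add_sum_erase _ _ heK, ← Finset.add_sum_erase _ _ heK, hrest] at h₀
    rw [he]
    exact h₀.add_right_cancel' _
  · have heK : e ∈ Finset.range K := Finset.mem_range.2 (by omega)
    have hrest : ∑ i ∈ (Finset.range K).erase e, f (blockPair L u (2 * i + 1)) =
        ∑ i ∈ (Finset.range K).erase e, f (blockPair L v (2 * i + 1)) :=
      Finset.sum_congr rfl fun i hi => by
        rw [Finset.mem_erase, Finset.mem_range] at hi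
        rw [hpair (2 * i + 1) (by omega) (by omega) (by omega)]
    rw [← Finset.add_sum_erase _ _ heK, ← Finset.add_sum_erase _ _ heK, hrest] at h₁
    rw [he]
    exact h₁.add_right_cancel' _

/-- A region of length at most `L` lies in two consecutive blocks of length `L`. -/
theorem exists_blocks {L K a b : ℕ} (hL : 0 < L) (hK : 0 < K) (hab : b ≤ a + L) (ha : a < L * (2 * K))
    (hb : b ≤ L * (2 * K)) : ∃ m, m + 1 < 2 * K ∧ m * L ≤ a ∧ b ≤ (m + 2) * L := by
  have h₁ := Nat.div_mul_le_self a L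
  have h₂ := Nat.lt_succ_iff.1 (Nat.lt_succ_of_lt (Nat.lt_div_mul_add (a := a) hL))
  rcases lt_or_ge (a / L + 1) (2 * K) with h | h
  · refine ⟨a / L, h, h₁, ?_⟩
    rw [add_mul]
    omega
  · have hlt : a / L < 2 * K := Nat.div_lt_of_lt_mul ha
    have he : a / L = 2 * K - 1 := by omega
    refine ⟨2 * K - 2, by omega, ?_, ?_⟩
    · exact (Nat.mul_le_mul_right L (by omega)).trans h₁
    · rw [show 2 * K - 2 + 2 = 2 * K by omega, mul_comm]
      exact hb

/-! ### Entries of permutations -/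

theorem entry_of_lt {n : ℕ} (u : Fin n → ℕ) {m : ℕ} (h : m < n) : entry u m = u ⟨m, h⟩ := dif_pos h

theorem entry_permVec_injOn {n : ℕ} (σ : Equiv.Perm (Fin n)) {l m : ℕ} (hl : l < n) (hm : m < n)
    (h : entry (permVec σ) l = entry (permVec σ) m) : l = m := by
  rw [entry_of_lt _ hl, entry_of_lt _ hm] at h
  exact congrArg Fin.val (permVec_injective_vec σ h)

theorem exists_entry_permVec_eq {n : ℕ} (σ τ : Equiv.Perm (Fin n)) {l : ℕ} (hl : l < n) :
    ∃ m < n, entry (permVec τ) m = entry (permVec σ) l := by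
  refine ⟨τ.symm (σ ⟨l, hl⟩), Fin.isLt _, ?_⟩
  rw [entry_of_lt _ (Fin.isLt _), entry_of_lt _ hl]
  simp [permVec]

theorem perm_eq_of_entry_eq {n : ℕ} {σ τ : Equiv.Perm (Fin n)}
    (h : ∀ m < n, entry (permVec σ) m = entry (permVec τ) m) : σ = τ := by
  refine permVec_injective (funext fun i => ?_)
  have := h i i.isLt
  rwa [entry_of_lt _ i.isLt, entry_of_lt _ i.isLt] at this

theorem sum_paritySeq_permVec {n : ℕ} (σ : Equiv.Perm (Fin n)) :
    ∑ m ∈ Finset.range n, paritySeq (permVec σ) m = ∑ i : Fin n, ((i : ℕ) + 1) % 2 := by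
  rw [Finset.sum_range, ← Equiv.sum_comp σ fun i : Fin n => ((i : ℕ) + 1) % 2]
  refine Finset.sum_congr rfl fun i _ => ?_
  rw [paritySeq, entry_of_lt _ i.isLt]
  rfl

theorem exists_burstShift {n t i j : ℕ} {σ τ : Equiv.Perm (Fin n)} (hij : i ≤ j) (hj : j + t ≤ n)
    (h : (List.ofFn (permVec σ)).take i ++ (List.ofFn (permVec σ)).drop (i + t) =
      (List.ofFn (permVec τ)).take j ++ (List.ofFn (permVec τ)).drop (j + t)) :
    IsBurstShift t i j n (entry (permVec σ)) (entry (permVec τ)) := by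
  have get : ∀ (u : Fin n → ℕ) (i m : ℕ), i + t ≤ n → m + t < n →
      ((List.ofFn u).take i ++ (List.ofFn u).drop (i + t))[m]? =
        some (if m < i then entry u m else entry u (m + t)) := by
    intro u i m hi hm
    rcases lt_or_ge m i with h | h
    · rw [List.getElem?_append_left (by simp; omega), List.getElem?_take_of_lt h, if_pos h,
        List.getElem?_ofFn, dif_pos (by omega), entry_of_lt _ (by omega)]
    · rw [List.getElem?_append_right (by simp; omega), List.getElem?_drop, if_neg (by omega),
        List.getElem?_ofFn, entry_of_lt _ hm, dif_pos (by simp; omega)]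
      congr 3
      simp
      omega
  have key : ∀ m, m + t < n →
      (if m < i then entry (permVec σ) m else entry (permVec σ) (m + t)) =
        if m < j then entry (permVec τ) m else entry (permVec τ) (m + t) := by
    intro m hm
    have h₁ := get (permVec σ) i m (by omega) hm
    rw [h, get (permVec τ) j m hj hm] at h₁
    exact (Option.some_injective _ h₁).symm
  refine ⟨hij, hj, fun m hm => ?_, fun m h₁ h₂ => ?_, fun m h₁ h₂ => ?_⟩
  · simpa [hm, show m < j by omega] using key m (by omega)
  · simpa [h₂, show ¬ m < i by omega] using key m (by omega)
  · have := key (m - t) (by omega)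
    rwa [if_neg (by omega), if_neg (by omega), show m - t + t = m by omega] at this

/-! ### The constraints on rows and blocks -/

theorem blockPair_permVec_injective {n L m : ℕ} (σ : Equiv.Perm (Fin n)) (hm : m + 1 < n / L) :
    Function.Injective (blockPair L (permVec σ) m) := by
  intro j j' h
  rw [blockPair_apply _ hm, blockPair_apply _ hm] at h
  have h₁ : (m + 2) * L ≤ n := (Nat.mul_le_mul_right L hm).trans (Nat.div_mul_le_self n L)
  rw [add_mul] at h₁
  have := entry_permVec_injOn σ (by omega) (by omega) h
  exact Fin.ext (by omega)

/-- A permutation uses each symbol once, so agreement outside the two blocks leaves the same symbols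
for the inside. -/
theorem image_blockPair_subset {n L m : ℕ} {σ τ : Equiv.Perm (Fin n)} (hm : m + 1 < n / L)
    (h : ∀ l, l < m * L ∨ (m + 2) * L ≤ l → entry (permVec σ) l = entry (permVec τ) l) :
    Finset.univ.image (blockPair L (permVec σ) m) ⊆
      Finset.univ.image (blockPair L (permVec τ) m) := by
  have h₁ : (m + 2) * L ≤ n := (Nat.mul_le_mul_right L hm).trans (Nat.div_mul_le_self n L)
  rw [add_mul] at h h₁
  intro r hr
  obtain ⟨j, -, rfl⟩ := Finset.mem_image.1 hr
  rw [blockPair_apply _ hm, Finset.mem_image]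
  obtain ⟨l, hl, hlj⟩ := exists_entry_permVec_eq σ τ (l := m * L + j) (by omega)
  by_cases hc : l < m * L ∨ m * L + 2 * L ≤ l
  · rw [← h l hc] at hlj
    have := entry_permVec_injOn σ hl (by omega) hlj
    omega
  · refine ⟨⟨l - m * L, by omega⟩, Finset.mem_univ _, ?_⟩
    rw [blockPair_apply _ hm, ← hlj]
    congr 1
    simp only
    omega

theorem image_blockPair_eq {n L m : ℕ} {σ τ : Equiv.Perm (Fin n)} (hm : m + 1 < n / L)
    (h : ∀ l, l < m * L ∨ (m + 2) * L ≤ l → entry (permVec σ) l = entry (permVec τ) l) :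
    Finset.univ.image (blockPair L (permVec σ) m) =
      Finset.univ.image (blockPair L (permVec τ) m) :=
  (image_blockPair_subset hm h).antisymm (image_blockPair_subset hm fun l hl => (h l hl).symm)

/-- The recover constraint for blocks of length `L` determines a permutation up to changes in a
region of length at most `L`. -/
theorem eq_of_mem_recover {n L a : ℕ} (hL : 0 < L) (hn : 2 * L ∣ n) {σ τ : Equiv.Perm (Fin n)}
    {d₁ d₂ : ZMod (2 * L).factorial} (hσ : σ ∈ recover n L d₁ d₂) (hτ : τ ∈ recover n L d₁ d₂)
    (ha : a < n) (h : ∀ l < n, l < a ∨ a + L ≤ l → entry (permVec σ) l = entry (permVec τ) l) :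
    σ = τ := by
  obtain ⟨K, hK⟩ := hn
  have hnL : n = L * (2 * K) := by rw [hK]; ring
  have hK0 : 0 < K := Nat.pos_of_ne_zero fun h0 => by simp [h0] at hK; omega
  have hdiv : n / (2 * L) = K := by rw [hK, Nat.mul_div_cancel_left _ (by omega)]
  have hdiv' : n / L = 2 * K := by rw [hnL, Nat.mul_div_cancel_left _ hL]
  obtain ⟨m, hm, hma, hmb⟩ := exists_blocks (a := a) (b := min (a + L) n) hL hK0 (by omega)
    (by omega) (by omega)
  have hagree : ∀ l, l < m * L ∨ (m + 2) * L ≤ l →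
      entry (permVec σ) l = entry (permVec τ) l := by
    intro l hl
    rcases lt_or_ge l n with hln | hln
    · exact h l hln (by omega)
    · rw [entry, entry, dif_neg (by omega), dif_neg (by omega)]
  have h₁ := (ZMod.natCast_eq_natCast_iff _ _ _).1 (hσ.1.trans hτ.1.symm)
  have h₂ := (ZMod.natCast_eq_natCast_iff _ _ _).1 (hσ.2.trans hτ.2.symm)
  rw [hdiv] at h₁ h₂
  have key := blockPair_modEq hL hnL hm hagree permRank h₁ h₂
  rw [← hdiv'] at hm
  rw [two_mul] at key
  have heq := eq_of_permRank_modEq (blockPair_permVec_injective σ hm)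
    (blockPair_permVec_injective τ hm) (image_blockPair_eq hm hagree) key
  refine perm_eq_of_entry_eq fun l _ => ?_
  by_cases hc : l < m * L ∨ (m + 2) * L ≤ l
  · exact hagree l hc
  · rw [add_mul] at hc
    have := congrFun heq ⟨l - m * L, by omega⟩
    rw [blockPair_apply _ hm, blockPair_apply _ hm] at this
    rwa [show m * L + (l - m * L) = l by omega] at this

theorem firstRowSum_blockPair {n k P m : ℕ} (hk : 0 < k) (σ : Equiv.Perm (Fin n))
    (hm : m + 1 < n / (P * k)) : firstRowSum k (blockPair (P * k) (permVec σ) m) =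
      ∑ l ∈ Finset.range (2 * P), rankIn (Finset.univ.image (blockPair (P * k) (permVec σ) m))
        (entry (permVec σ) ((m * P + l) * k)) := by
  have hlen : (P * k + P * k) / k = 2 * P := by
    rw [← add_mul, Nat.mul_div_cancel _ hk]
    ring
  unfold firstRowSum firstRow
  rw [Fin.sum_univ_eq_sum_range
    (fun l => entry (projection (blockPair (P * k) (permVec σ) m)) (l * k)), hlen]
  refine Finset.sum_congr rfl fun l hl => ?_
  have hlk : l * k < P * k + P * k := by
    rw [← add_mul, ← two_mul]
    exact Nat.mul_lt_mul_of_pos_right (Finset.mem_range.1 hl) hk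
  rw [entry_of_lt _ hlk, projection_eq_rankIn (blockPair_permVec_injective σ hm),
    blockPair_apply _ hm]
  congr 2
  simp only
  ring

/-- The first row after a burst deletion of length `k`. -/
theorem IsBurstShift.row {n k i j N : ℕ} {u v : ℕ → ℕ} (h : IsBurstShift k i j n u v)
    (hn : n = k * N) {i' j' : ℕ} (hi : i ≤ i' * k) (hi' : i' * k < i + k) (hj : j ≤ j' * k) (hj' : j' * k < j + k) :
    IsBurstShift 1 i' j' N (fun l => u (l * k)) (fun l => v (l * k)) := by
  have hk : 0 < k := by omega
  subst hn
  have hb := h.bound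
  have hle := h.le
  have mono : ∀ a b, a < b → a * k + k ≤ b * k := fun a b hab => by
    simpa [add_mul] using Nat.mul_le_mul_right k (Nat.succ_le_of_lt hab)
  refine ⟨?_, ?_, fun l hl => ?_, fun l h₁ h₂ => ?_, fun l h₁ h₂ => ?_⟩
  · by_contra hc
    have := mono j' i' (by omega)
    omega
  · by_contra hc
    have := Nat.mul_le_mul_right k (show N ≤ j' by omega)
    rw [mul_comm N] at this
    omega
  · have := mono l i' hl
    exact h.left _ (by omega)
  · have := Nat.mul_le_mul_right k h₁
    have := mono l j' h₂
    have := h.mid (l * k) (by omega) (by omega)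
    simpa [add_mul] using this
  · have := mono j' l (by omega)
    have := mono l N h₂
    rw [mul_comm N] at this
    exact h.right _ (by omega) (by omega)

/-- The retrieve constraint identifies the symbol deleted from the first row. -/
theorem entry_eq_of_mem_retrieve {n k P i j i' j' : ℕ} (hk : 0 < k) (hP : 0 < P) (hn0 : 0 < n)
    (hn : 2 * P * k ∣ n) {σ τ : Equiv.Perm (Fin n)} {c₁ c₂ : ZMod (2 * P * k)}
    (hσ : σ ∈ retrieve n k P c₁ c₂) (hτ : τ ∈ retrieve n k P c₁ c₂)
    (h : IsBurstShift k i j n (entry (permVec σ)) (entry (permVec τ)))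
    (hij : j + k ≤ i + P * k)
    (hi : i ≤ i' * k) (hi' : i' * k < i + k) (hj : j ≤ j' * k) (hj' : j' * k < j + k) :
    entry (permVec σ) (i' * k) = entry (permVec τ) (j' * k) := by
  obtain ⟨K, hK⟩ := hn
  have hL : 0 < P * k := Nat.mul_pos hP hk
  have hnL : n = P * k * (2 * K) := by rw [hK]; ring
  have hnk : n = k * (P * (2 * K)) := by rw [hK]; ring
  have hK0 : 0 < K := Nat.pos_of_ne_zero fun h0 => by simp [h0] at hK; omega
  have hdiv : n / (2 * P * k) = K := by
    rw [hK, Nat.mul_div_cancel_left _ (by rw [mul_assoc]; omega)]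
  have hdiv' : n / (P * k) = 2 * K := by rw [hnL, Nat.mul_div_cancel_left _ hL]
  have hb := h.bound
  obtain ⟨m, hm, hma, hmb⟩ := exists_blocks (a := i) (b := j + k) hL hK0 (by omega)
    (by have := h.le; omega) (by omega)
  have hagree : ∀ l, l < m * (P * k) ∨ (m + 2) * (P * k) ≤ l →
      entry (permVec σ) l = entry (permVec τ) l := by
    intro l hl
    rcases lt_or_ge l n with hln | hln
    · rcases hl with hl | hl
      · exact h.left l (by omega)
      · exact h.right l (by omega) hln
    · rw [entry, entry, dif_neg (by omega), dif_neg (by omega)]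
  have h₁ := (ZMod.natCast_eq_natCast_iff _ _ _).1 (hσ.1.trans hτ.1.symm)
  have h₂ := (ZMod.natCast_eq_natCast_iff _ _ _).1 (hσ.2.trans hτ.2.symm)
  rw [hdiv] at h₁ h₂
  have key := blockPair_modEq hL hnL hm hagree (firstRowSum k) h₁ h₂
  have hm₂ := hm
  rw [← hdiv'] at hm
  rw [firstRowSum_blockPair hk σ hm, firstRowSum_blockPair hk τ hm,
    ← image_blockPair_eq hm hagree] at key
  have hR : (Finset.univ.image (blockPair (P * k) (permVec σ) m)).card ≤ 2 * P * k := by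
    refine Finset.card_image_le.trans ?_
    rw [Finset.card_univ, Fintype.card_fin]
    exact le_of_eq (by ring)
  have memσ : ∀ ρ : Equiv.Perm (Fin n), ∀ l, m * (P * k) ≤ l → l < (m + 2) * (P * k) →
      entry (permVec ρ) l ∈ Finset.univ.image (blockPair (P * k) (permVec ρ) m) := by
    intro ρ l h₃ h₄
    rw [add_mul] at h₄
    refine Finset.mem_image.2 ⟨⟨l - m * (P * k), by omega⟩, Finset.mem_univ _, ?_⟩
    rw [blockPair_apply _ hm]
    congr 1
    simp only
    omega
  have hleij := h.le
  have mi := memσ σ (i' * k) (by omega) (by omega)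
  have mj := memσ τ (j' * k) (by omega) (by omega)
  rw [← image_blockPair_eq hm hagree] at mj
  generalize Finset.univ.image (blockPair (P * k) (permVec σ) m) = R at *
  have hw₁ : m * P ≤ i' := by
    refine Nat.le_of_mul_le_mul_right (c := k) ?_ hk
    rw [mul_assoc]
    omega
  have hw₂ : j' + 1 ≤ m * P + 2 * P := by
    have : j' * k < (m * P + 2 * P) * k := by
      rw [← add_mul, mul_assoc]
      omega
    exact Nat.lt_of_mul_lt_mul_right this
  have hw₃ : m * P + 2 * P ≤ P * (2 * K) := by
    rw [← add_mul, mul_comm P]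
    exact Nat.mul_le_mul_right P hm₂
  -- In the rank sums over the first row of the two blocks, everything cancels except the two
  -- deleted entries. Their ranks are thus congruent modulo `2 * P * k`, the number of symbols
  -- there.
  have hrow := (((h.row hnk hi hi' hj hj').window hw₁ hw₂ hw₃).comp (rankIn R)).sum_eq
  simp only [Nat.Ico_succ_singleton, Finset.sum_singleton] at hrow
  rw [Nat.add_sub_cancel' hw₁,
    Nat.add_sub_cancel' (hw₁.trans (h.row hnk hi hi' hj hj').le)] at hrow
  have hmod : rankIn R (entry (permVec σ) (i' * k)) ≡
      rankIn R (entry (permVec τ) (j' * k)) [MOD 2 * P * k] :=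
    (key.symm.add_left_cancel (by rw [hrow]))
  exact rankIn_injOn mi mj (eq_of_modEq_of_pos hmod (by unfold rankIn; omega)
    ((rankIn_le_card mi).trans hR) (by unfold rankIn; omega) ((rankIn_le_card mj).trans hR))

/-! ### Admissible lengths -/

theorem windowLen_bounds {n s k : ℕ} (hk : 0 < k) :
    delta n s + k ≤ k * windowLen n s k + 1 ∧ k * windowLen n s k + 1 < delta n s + 2 * k := by
  rw [windowLen, Nat.ceilDiv_eq_add_pred_div]
  have h₁ := Nat.div_mul_le_self (delta n s + k - 1 + k - 1) k
  have h₂ := Nat.lt_div_mul_add (a := delta n s + k - 1 + k - 1) hk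
  rw [mul_comm] at h₁ h₂
  omega

theorem windowLen_one (n s : ℕ) : windowLen n s 1 = delta n s := by
  have := windowLen_bounds (n := n) (s := s) one_pos
  omega

theorem Admissible.two_mul_dvd {n s k : ℕ} (h : Admissible n s) (hk : 1 ≤ k) (hks : k ≤ s) :
    2 * (k * windowLen n s k) ∣ n :=
  (Nat.mul_dvd_mul_left 2 (Finset.dvd_prod_of_mem (fun k => k * windowLen n s k)
    (Finset.mem_Icc.2 ⟨hk, hks⟩))).trans h.2.2.2

theorem Admissible.windowLen_pos {n s k : ℕ} (h : Admissible n s) (hk : 1 ≤ k) (hks : k ≤ s) :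
    0 < windowLen n s k := by
  refine Nat.pos_of_ne_zero fun h0 => ?_
  have := h.two_mul_dvd hk hks
  rw [h0, mul_zero, mul_zero, Nat.zero_dvd] at this
  exact h.1.ne' this

theorem Admissible.two_mul_delta_dvd {n s : ℕ} (h : Admissible n s) (hs : 1 ≤ s) :
    2 * delta n s ∣ n := by
  simpa [windowLen_one] using h.two_mul_dvd le_rfl hs

theorem Admissible.two_mul_delta_le {n s : ℕ} (h : Admissible n s) (hs : 1 ≤ s) :
    2 * delta n s ≤ n := Nat.le_of_dvd h.1 (h.two_mul_delta_dvd hs)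

theorem Admissible.four_mul_dvd {n s : ℕ} (h : Admissible n s) (hs : 1 ≤ s) :
    2 * (2 * s) ∣ n := by
  refine Dvd.dvd.trans (Nat.mul_dvd_mul_left 2 ?_) (h.two_mul_delta_dvd hs)
  rw [delta, pow_succ']
  exact ⟨2 ^ (2 * s) * Nat.clog 2 n, by ring⟩

/-- A bootstrap: `δ ≠ 0` because `P_1 = δ` is positive, so `δ ≥ 8s`. Then `n ≥ 2δ ≥ 16` gives `⌈log
n⌉ ≥ 4`, which improves the bound to `32s`. -/
theorem Admissible.le_delta {n s : ℕ} (h : Admissible n s) (hs : 1 ≤ s) :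
    32 * s ≤ delta n s := by
  have hpos := h.windowLen_pos le_rfl hs
  rw [windowLen_one] at hpos
  have hpow : 8 ≤ 2 ^ (2 * s + 1) := by
    calc 8 = 2 ^ 3 := by norm_num
      _ ≤ 2 ^ (2 * s + 1) := Nat.pow_le_pow_right (by norm_num) (by omega)
  have hlow : ∀ c, c ≤ Nat.clog 2 n → s * 8 * c ≤ delta n s := fun c hc =>
    Nat.mul_le_mul (Nat.mul_le_mul_left s hpow) hc
  have hclog : 1 ≤ Nat.clog 2 n := Nat.one_le_iff_ne_zero.2 fun h0 => by
    rw [delta, h0, mul_zero] at hpos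
    omega
  have hn := h.two_mul_delta_le hs
  have h₁ := hlow 1 hclog
  have h₂ : 4 ≤ Nat.clog 2 n := by
    have : Nat.clog 2 (2 ^ 4) ≤ Nat.clog 2 n := Nat.clog_mono_right 2 (by omega)
    rwa [Nat.clog_pow 2 4 (by norm_num)] at this
  have h₃ := hlow 4 h₂
  omega

/-! ### The code corrects bursts -/

theorem mem_SVT_row_of_mem_code {n s k : ℕ} {q : Params n s} {σ : Equiv.Perm (Fin n)}
    (hσ : σ ∈ code n s q) (hk : 1 ≤ k) (hks : k ≤ s) :
    signature (firstRow k (permVec σ)) ∈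
      SVT (n / k - 1) (windowLen n s k) (q.bOdd k) (q.bEven k) := by
  rcases eq_or_lt_of_le hk with rfl | hk
  · have hrow : ∀ m (h : m = n) (w : Fin m → ℕ), (∀ l, entry w l = entry (permVec σ) l) →
        signature w ∈ SVT (m - 1) (windowLen n s 1) (q.bOdd 1) (q.bEven 1) := by
      rintro m rfl w hw
      have : w = permVec σ := funext fun i => by
        have := hw i
        rwa [entry_of_lt _ i.isLt, entry_of_lt _ i.isLt] at this
      rw [this]
      exact hσ.2.1
    refine hrow _ (Nat.div_one n) _ fun l => ?_
    rcases lt_or_ge l (n / 1) with hl | hl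
    · rw [entry_of_lt _ hl, firstRow, mul_one]
    · have hl' : ¬ l < n := by rw [Nat.div_one] at hl; omega
      rw [entry, entry, dif_neg (by omega), dif_neg hl']
  · exact (hσ.2.2.2 k hk hks).2

theorem eq_of_burstShift_of_mem_code {n s t i j : ℕ} (hs : 1 ≤ s) (hn : Admissible n s)
    {q : Params n s} {σ τ : Equiv.Perm (Fin n)} (hσ : σ ∈ code n s q) (hτ : τ ∈ code n s q)
    (ht : 1 ≤ t) (hts : t ≤ s)
    (h : IsBurstShift t i j n (entry (permVec σ)) (entry (permVec τ))) : σ = τ := by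
  have hδ := hn.le_delta hs
  have hδn := hn.two_mul_delta_le hs
  have hb := h.bound
  have hle := h.le
  obtain ⟨hc, hp⟩ := locate_positions hσ.1 hτ.1
  have hloc : j + t < i + delta n s :=
    (h.comp fun a => a % 2).locate hs ht hts hδ hδn
      ((sum_paritySeq_permVec σ).trans (sum_paritySeq_permVec τ).symm)
      ((isDense_iff _).1 hσ.1.1) ((isDense_iff _).1 hτ.1.1) hc hp
  obtain ⟨hP, hP'⟩ := windowLen_bounds (n := n) (s := s) (k := t) ht
  have hP0 := hn.windowLen_pos ht hts
  have hdvd := hn.two_mul_dvd ht hts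
  set P := windowLen n s t with hPdef
  -- The unique multiple of `t` in `[a, a + t)`, which is the first-row entry that a burst at `a`
  -- removes.
  have hceil : ∀ a, ∃ b, a ≤ b * t ∧ b * t < a + t := fun a => by
    refine ⟨(a + t - 1) / t, ?_, ?_⟩
    · have := Nat.lt_div_mul_add (a := a + t - 1) (b := t) ht
      omega
    · have := Nat.div_mul_le_self (a + t - 1) t
      omega
  obtain ⟨i', hi, hi'⟩ := hceil i
  obtain ⟨j', hj, hj'⟩ := hceil j
  obtain ⟨N, hN⟩ : t ∣ n := Dvd.dvd.trans ⟨2 * P, by ring⟩ hdvd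
  have hrow := h.row hN hi hi' hj hj'
  have hsym : entry (permVec σ) (i' * t) = entry (permVec τ) (j' * t) := by
    -- For `t = 1` there is no retrieve constraint: the deleted symbol is the one missing from the
    -- common word.
    rcases eq_or_lt_of_le ht with rfl | ht₂
    · obtain rfl : i' = i := by omega
      obtain rfl : j' = j := by omega
      rw [mul_one, mul_one]
      obtain ⟨l, hl, hlτ⟩ := exists_entry_permVec_eq σ τ (l := i') (by omega)
      have inj := fun a ha => entry_permVec_injOn σ (l := a) (m := i') ha (by omega)
      rcases lt_trichotomy l j' with hlt | rfl | hlt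
      · rcases lt_or_ge l i' with hli | hli
        · have := inj l hl (by rw [h.left l hli, hlτ])
          omega
        · have := inj (l + 1) (by omega) (by rw [h.mid l hli hlt, hlτ])
          omega
      · exact hlτ.symm
      · have := inj l hl (by rw [h.right l hlt hl, hlτ])
        omega
    · exact entry_eq_of_mem_retrieve ht hP0 hn.1 (by rwa [mul_assoc, mul_comm P])
        (hσ.2.2.2 t ht₂ hts).1 (hτ.2.2.2 t ht₂ hts).1 h (by rw [mul_comm P]; omega) hi hi' hj hj'
  have hnt : n / t = N := by rw [hN, Nat.mul_div_cancel_left _ ht]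
  have hentry : ∀ (ρ : Equiv.Perm (Fin n)) l, l < n / t →
      entry (firstRow t (permVec ρ)) l = entry (permVec ρ) (l * t) := fun ρ l hl => by
    rw [entry_of_lt _ hl]
    rfl
  have hshift : IsBurstShift 1 i' j' (n / t) (entry (firstRow t (permVec σ)))
      (entry (firstRow t (permVec τ))) := by
    rw [← hnt] at hrow
    have hb' := hrow.bound
    have hle' := hrow.le
    refine ⟨hrow.le, hrow.bound, fun m hm => ?_, fun m h₁ h₂ => ?_, fun m h₁ h₂ => ?_⟩
    · rw [hentry _ _ (by omega), hentry _ _ (by omega)]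
      exact hrow.left m hm
    · rw [hentry _ _ (by omega), hentry _ _ (by omega)]
      exact hrow.mid m h₁ h₂
    · rw [hentry _ _ (by omega), hentry _ _ (by omega)]
      exact hrow.right m h₁ h₂
  have hinj : Function.Injective (firstRow t (permVec σ)) := by
    intro a b hab
    have hlt : ∀ c : Fin (n / t), (c : ℕ) * t < n := fun c =>
      (Nat.mul_lt_mul_of_pos_right c.isLt ht).trans_le (Nat.div_mul_le_self n t)
    have := entry_permVec_injOn σ (hlt a) (hlt b) hab
    exact Fin.ext (Nat.eq_of_mul_eq_mul_right ht this)
  have hbi := hshift.bound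
  have hlei := hshift.le
  -- Here `t * P ≥ δ + t - 1` is used: `i' + P ≤ j' + 1` would give `i + δ ≤ j + t`.
  have hclose : j' + 2 ≤ i' + P := by
    by_contra hcon
    have h₁ := Nat.mul_le_mul_right t (show i' + P ≤ j' + 1 by omega)
    rw [add_mul, add_mul, one_mul, mul_comm P] at h₁
    omega
  have heq : i' = j' := hshift.eq_of_mem_SVT hinj
    (by rw [hentry _ _ (by omega), hentry _ _ (by omega)]; exact hsym) hclose
    (mem_SVT_row_of_mem_code hσ ht hts) (mem_SVT_row_of_mem_code hτ ht hts)
  subst heq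
  -- Both bursts contain `i' * t`, so `j < i + t` and the region ends before `i + 2 * t ≤ i + 2 *
  -- s`.
  refine eq_of_mem_recover (by omega) (hn.four_mul_dvd hs) hσ.2.2.1 hτ.2.2.1
    (a := i) (by omega) fun l hl hor => ?_
  rcases hor with hl' | hl'
  · exact h.left l hl'
  · exact h.right l (by omega) hl

theorem isLeBSDCode_code {n s : ℕ} (hs : 1 ≤ s) (hn : Admissible n s) (q : Params n s) :
    IsLeBSDCode s (code n s q) := by
  intro σ hσ τ hτ hne
  rw [Set.disjoint_left]
  intro w hw hw'
  simp only [Set.mem_iUnion] at hw hw'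
  obtain ⟨t, hts, i, hi, hwi⟩ := hw
  obtain ⟨t', hts', j, hj, hwj⟩ := hw'
  have hlen := congrArg List.length (hwi.symm.trans hwj)
  simp only [List.length_append, List.length_take, List.length_drop, List.length_ofFn] at hlen
  obtain rfl : t = t' := by omega
  have h := hwi.symm.trans hwj
  rcases Nat.eq_zero_or_pos t with rfl | ht
  · simp only [add_zero, List.take_append_drop] at h
    exact hne (permVec_injective (List.ofFn_injective h))
  rcases le_total i j with hij | hij
  · exact hne (eq_of_burstShift_of_mem_code hs hn hσ hτ ht hts (exists_burstShift hij hj h))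
  · exact hne (eq_of_burstShift_of_mem_code hs hn hτ hσ ht hts
      (exists_burstShift hij hi h.symm)).symm

/-! ### Permutations with a dense parity word -/

theorem exists_dense {n s : ℕ} (hs : 1 ≤ s) (hn : Admissible n s) :
    ∃ σ : Equiv.Perm (Fin n), IsDense (pattern s) (delta n s) (parity (permVec σ)) := by
  have hδ := hn.le_delta hs
  obtain ⟨N, hN⟩ : 2 * s ∣ n := (Dvd.intro_left 2 rfl).trans (hn.four_mul_dvd hs)
  have hdm : ∀ i, 2 * s * (i / (2 * s)) + i % (2 * s) = i := fun i => Nat.div_add_mod i (2 * s)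
  have hmod : ∀ i, i % (2 * s) < 2 * s := fun i => Nat.mod_lt _ (by omega)
  -- Each block of `2 * s` positions keeps its own values, odd ones first. The symbol is `g i + 1`,
  -- so the parity word is the periodic repetition of `0^s 1^s`.
  let g : ℕ → ℕ := fun i =>
    if i % (2 * s) < s then 2 * (s * (i / (2 * s)) + i % (2 * s)) + 1
    else 2 * (s * (i / (2 * s)) + (i % (2 * s) - s))
  have hg : ∀ i, g i = 2 * s * (i / (2 * s)) +
      if i % (2 * s) < s then 2 * (i % (2 * s)) + 1 else 2 * (i % (2 * s) - s) := fun i => by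
    simp only [g]
    split_ifs <;> ring
  have hglt : ∀ i, g i < 2 * s * (i / (2 * s)) + 2 * s := fun i => by
    rw [hg]
    have := hmod i
    split_ifs <;> omega
  have hgn : ∀ i < n, g i < n := fun i hi => by
    have h₁ : i / (2 * s) + 1 ≤ N := Nat.div_lt_of_lt_mul (by rwa [← hN])
    have h₂ := Nat.mul_le_mul_left (2 * s) h₁
    rw [mul_add, mul_one, ← hN] at h₂
    exact (hglt i).trans_le h₂
  have hgdiv : ∀ i, g i / (2 * s) = i / (2 * s) := fun i => by
    refine Nat.div_eq_of_lt_le ?_ ?_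
    · rw [hg, mul_comm]
      omega
    · rw [add_mul, one_mul, mul_comm]
      exact hglt i
  have hinj : ∀ i j, g i = g j → i = j := fun i j hij => by
    have hd : i / (2 * s) = j / (2 * s) := by rw [← hgdiv i, ← hgdiv j, hij]
    rw [hg, hg, hd] at hij
    have h₁ := hdm i
    have h₂ := hdm j
    rw [hd] at h₁
    have := hmod i
    have := hmod j
    split_ifs at hij <;> omega
  let f : Fin n → Fin n := fun i => ⟨g i, hgn i i.isLt⟩
  have hf : Function.Injective f := fun i j hij =>
    Fin.ext (hinj i j (congrArg Fin.val hij))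
  refine ⟨Equiv.ofBijective f (Finite.injective_iff_bijective.1 hf), ?_⟩
  rw [isDense_iff]
  intro a ha
  refine ⟨2 * s * ((a + 2 * s - 1) / (2 * s)), ?_, ?_, fun l hl => ?_⟩
  · have := Nat.lt_mul_div_succ (a + 2 * s - 1) (show 0 < 2 * s by omega)
    rw [mul_add] at this
    omega
  · have := Nat.mul_div_le (a + 2 * s - 1) (2 * s)
    omega
  · have hlt : 2 * s * ((a + 2 * s - 1) / (2 * s)) + l < n := by
      have := Nat.mul_div_le (a + 2 * s - 1) (2 * s)
      omega
    rw [paritySeq, entry_of_lt _ hlt]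
    simp only [permVec, Equiv.ofBijective_apply, f]
    rw [show ∀ i, (g i + 1) % 2 = if i % (2 * s) < s then 0 else 1 from fun i => by
      simp only [g]
      split_ifs <;> omega, Nat.mul_add_mod, Nat.mod_eq_of_lt hl]

/-- Relative to one extension `σ₀`, every other differs by a permutation fixing the range of `e`
pointwise. -/
theorem card_perm_extending_le {n : ℕ} {ι : Type*} [Fintype ι] {e : ι → Fin n}
    (he : Function.Injective e) (f : ι → Fin n) :
    (Finset.univ.filter fun σ : Equiv.Perm (Fin n) => ∀ x, σ (e x) = f x).card ≤
      (n - Fintype.card ι).factorial := by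
  rcases Finset.eq_empty_or_nonempty
    (Finset.univ.filter fun σ : Equiv.Perm (Fin n) => ∀ x, σ (e x) = f x) with h | ⟨σ₀, h₀⟩
  · rw [h]
    simp
  · rw [Finset.mem_filter] at h₀
    classical
    let p : Fin n → Prop := fun a => a ∉ Set.range e
    have hcard : Fintype.card {τ : Equiv.Perm (Fin n) // ∀ a, ¬ p a → τ a = a} =
        (n - Fintype.card ι).factorial := by
      rw [← Fintype.card_congr (Equiv.Perm.subtypeEquivSubtypePerm p), Fintype.card_perm]
      congr 1
      rw [Fintype.card_subtype_compl, Fintype.card_fin]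
      congr 1
      exact Set.card_range_of_injective he
    rw [← hcard, ← Fintype.card_coe]
    refine Fintype.card_le_of_injective
      (fun σ => ⟨σ₀⁻¹ * σ.1, fun a ha => ?_⟩) fun σ τ h => ?_
    · obtain ⟨x, rfl⟩ := not_not.1 ha
      have hσ := (Finset.mem_filter.1 σ.2).2 x
      rw [Equiv.Perm.mul_apply, hσ, ← h₀.2 x]
      exact σ₀.symm_apply_apply _
    · exact Subtype.ext (mul_left_cancel (congrArg Subtype.val h))

theorem card_filter_parity {n : ℕ} (hn : Even n) {c : ℕ} (hc : c ≤ 1) :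
    (Finset.univ.filter fun v : Fin n => ((v : ℕ) + 1) % 2 = c).card = n / 2 := by
  obtain ⟨h, rfl⟩ := hn
  rw [Finset.card_filter, Fin.sum_univ_eq_sum_range fun v => if (v + 1) % 2 = c then 1 else 0]
  rw [← two_mul, Nat.mul_div_cancel_left _ two_pos]
  induction h with
  | zero => rfl
  | succ h ih =>
    rw [show 2 * (h + 1) = 2 * h + 1 + 1 by ring, Finset.sum_range_succ, Finset.sum_range_succ, ih]
    split_ifs <;> omega

/-- Permutations whose parity word avoids the pattern at given disjoint places. -/
theorem card_avoiding_le {n s M a : ℕ} (hn : Even n) (ha : a + 2 * s * M ≤ n) :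
    (Finset.univ.filter fun σ : Equiv.Perm (Fin n) =>
      ∀ b < M, ¬ PatternAt s (paritySeq (permVec σ)) (a + 2 * s * b)).card ≤
    (n - 2 * s * M).factorial * (n ^ (2 * s) - (n / 2) ^ (2 * s)) ^ M := by
  have hlt : ∀ (b : Fin M) (l : Fin (2 * s)), a + 2 * s * b + l < n := fun b l => by
    have h₁ := Nat.mul_le_mul_left (2 * s) (Nat.succ_le_of_lt b.isLt)
    rw [Nat.succ_eq_add_one, mul_add, mul_one] at h₁
    omega
  let e : Fin M × Fin (2 * s) → Fin n := fun x => ⟨a + 2 * s * x.1 + x.2, hlt x.1 x.2⟩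
  have he : Function.Injective e := by
    rintro ⟨b, l⟩ ⟨b', l'⟩ h
    have h := congrArg Fin.val h
    simp only [e] at h
    have h₁ : l.val + 2 * s * b = l'.val + 2 * s * b' := by omega
    have h₂ : (b : ℕ) = b' := by
      have := congrArg (· / (2 * s)) h₁
      simpa [Nat.add_mul_div_left _ _ (Nat.zero_lt_of_lt l.isLt), Nat.div_eq_of_lt] using this
    rw [h₂] at h₁
    exact Prod.ext (Fin.ext h₂) (Fin.ext (by simpa using h₁))
  -- Value tuples that spell the pattern. Distinctness of values is dropped, which makes the `M`
  -- places independent at the cost of overcounting.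
  let G : Finset (Fin (2 * s) → Fin n) := Fintype.piFinset fun l =>
    Finset.univ.filter fun v : Fin n => ((v : ℕ) + 1) % 2 = if (l : ℕ) < s then 0 else 1
  have hG : G.card = (n / 2) ^ (2 * s) := by
    rw [Fintype.card_piFinset, Finset.prod_congr rfl fun l _ =>
      card_filter_parity hn (by split_ifs <;> omega)]
    simp
  have hT : (Fintype.piFinset fun _ : Fin M => Gᶜ).card =
      (n ^ (2 * s) - (n / 2) ^ (2 * s)) ^ M := by
    rw [Fintype.card_piFinset, Finset.prod_const, Finset.card_compl, hG]
    simp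
  rw [← hT]
  refine Finset.card_le_mul_card_image_of_maps_to
    (f := fun (σ : Equiv.Perm (Fin n)) (b : Fin M) (l : Fin (2 * s)) => σ (e (b, l)))
    (fun σ hσ => ?_) _ fun f _ => ?_
  · rw [Finset.mem_filter] at hσ
    rw [Fintype.mem_piFinset]
    intro b
    rw [Finset.mem_compl]
    intro hb
    refine hσ.2 b b.isLt fun l hl => ?_
    have := (Finset.mem_filter.1 (Fintype.mem_piFinset.1 hb ⟨l, hl⟩)).2
    rw [paritySeq, entry_of_lt _ (hlt b ⟨l, hl⟩)]
    exact this
  · have h := card_perm_extending_le he fun x => f x.1 x.2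
    rw [Fintype.card_prod, Fintype.card_fin, Fintype.card_fin, mul_comm M] at h
    refine le_trans (Finset.card_le_card fun σ hσ => ?_) h
    rw [Finset.mem_filter] at hσ ⊢
    refine ⟨Finset.mem_univ _, fun x => ?_⟩
    rw [← hσ.2]

theorem Admissible.even {n s : ℕ} (h : Admissible n s) : Even n :=
  even_iff_two_dvd.2 (Dvd.dvd.trans (Dvd.intro _ rfl) h.2.2.2)

open Classical in
/-- At least half of the permutations have a dense parity word when `n` is large. -/
theorem factorial_le_two_mul_card_dense {n s : ℕ} (hs : 1 ≤ s) (hn : Admissible n s)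
    (hlarge : 2 * delta n s ^ 2 ≤ n) (hlog : 5 ≤ Nat.clog 2 n) :
    n.factorial ≤ 2 * (Finset.univ.filter fun σ : Equiv.Perm (Fin n) =>
      IsDense (pattern s) (delta n s) (parity (permVec σ))).card := by
  have hδn := hn.two_mul_delta_le hs
  have hδs := hn.le_delta hs
  set δ := delta n s with hδ
  set L := Nat.clog 2 n with hL
  set M := 4 ^ s * L with hM
  have hδM : δ = 2 * s * M := by
    rw [hδ, delta, pow_succ, pow_mul]
    ring
  let bad : ℕ → Finset (Equiv.Perm (Fin n)) := fun a => Finset.univ.filter fun σ =>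
    ∀ b < M, ¬ PatternAt s (paritySeq (permVec σ)) (a + 2 * s * b)
  let W := Finset.range (n - δ + 1)
  have hcover : (Finset.univ.filter fun σ : Equiv.Perm (Fin n) =>
      ¬ IsDense (pattern s) δ (parity (permVec σ))) ⊆ W.biUnion bad := by
    intro σ hσ
    have hσ := (Finset.mem_filter.1 hσ).2
    rw [isDense_iff] at hσ
    push Not at hσ
    obtain ⟨a, ha, hσ⟩ := hσ
    rw [Finset.mem_biUnion]
    refine ⟨a, Finset.mem_range.2 (by omega), Finset.mem_filter.2 ⟨Finset.mem_univ _, ?_⟩⟩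
    intro b hb
    have := Nat.mul_le_mul_left (2 * s) (Nat.succ_le_of_lt hb)
    rw [← hδM, Nat.succ_eq_add_one, mul_add, mul_one] at this
    exact hσ _ (by omega) (by omega)
  have hbad : ∀ a ∈ W, (bad a).card ≤
      (n - δ).factorial * (n ^ (2 * s) - (n / 2) ^ (2 * s)) ^ M := fun a ha => by
    have := Finset.mem_range.1 ha
    rw [hδM]
    exact card_avoiding_le hn.even (by omega)
  have hcount : (Finset.univ.filter fun σ : Equiv.Perm (Fin n) =>
      ¬ IsDense (pattern s) δ (parity (permVec σ))).card ≤
        n * ((n - δ).factorial * (n ^ (2 * s) - (n / 2) ^ (2 * s)) ^ M) := by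
    refine (Finset.card_le_card hcover).trans (Finset.card_biUnion_le.trans ?_)
    refine (Finset.sum_le_sum hbad).trans ?_
    rw [Finset.sum_const, smul_eq_mul, Finset.card_range]
    exact Nat.mul_le_mul_right _ (by omega)
  have hn0 : (0 : ℝ) < n := by exact_mod_cast hn.1
  have hpow : ((n ^ (2 * s) - (n / 2) ^ (2 * s) : ℕ) : ℝ) = n ^ (2 * s) * (1 - (4 ^ s)⁻¹) := by
    have h2 : ((n / 2 : ℕ) : ℝ) = n / 2 := by
      rw [Nat.cast_div hn.even.two_dvd (by norm_num)]
      norm_num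
    rw [Nat.cast_sub (Nat.pow_le_pow_left (Nat.div_le_self n 2) _)]
    push_cast
    rw [h2, div_pow, pow_mul (2 : ℝ)]
    norm_num
    ring
  -- A place carries the pattern with probability `4^(-s)` in the independent model, and `δ` leaves
  -- room for `M = 4^s L` places.
  have hexp : (1 - ((4 : ℝ) ^ s)⁻¹) ^ M ≤ Real.exp (-L) := by
    have h₁ : ((4 : ℝ) ^ s)⁻¹ ≤ 1 := inv_le_one_of_one_le₀ (one_le_pow₀ (by norm_num))
    calc (1 - ((4 : ℝ) ^ s)⁻¹) ^ M ≤ Real.exp (-((4 : ℝ) ^ s)⁻¹) ^ M :=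
          pow_le_pow_left₀ (by linarith) (Real.one_sub_le_exp_neg _) _
      _ = Real.exp (-L) := by
          rw [← Real.exp_nat_mul]
          congr 1
          rw [hM]
          push_cast
          field_simp
  -- `n ≤ 2^L` and `2 / e < 3 / 4`; the fifth power of `3 / 4` is the first below `1 / 4`.
  have hnexp : (n : ℝ) * Real.exp (-L) ≤ 1 / 4 := by
    have h₁ : (n : ℝ) ≤ 2 ^ L := by exact_mod_cast Nat.le_pow_clog (by norm_num) n
    have h₂ : Real.exp (-L) = (Real.exp (-1)) ^ L := by
      rw [← Real.exp_nat_mul]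
      congr 1
      ring
    have h₃ : 2 * Real.exp (-1) ≤ 3 / 4 := by
      have := Real.exp_neg_one_lt_d9
      linarith
    calc (n : ℝ) * Real.exp (-L) ≤ 2 ^ L * Real.exp (-1) ^ L := by
          rw [h₂]
          gcongr
      _ = (2 * Real.exp (-1)) ^ L := (mul_pow _ _ _).symm
      _ ≤ (3 / 4) ^ L := pow_le_pow_left₀ (by positivity) h₃ _
      _ ≤ (3 / 4) ^ 5 := pow_le_pow_of_le_one (by norm_num) (by norm_num) hlog
      _ ≤ 1 / 4 := by norm_num
  -- The price of dropping distinctness is a factor 2, by Bernoulli's inequality and `2 * δ ^ 2 ≤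
  -- n`.
  have hfact : (n : ℝ) ^ δ * (n - δ).factorial ≤ 2 * n.factorial := by
    have h₁ : (n - δ) ^ δ * (n - δ).factorial ≤ n.factorial := by
      rw [← Nat.factorial_mul_descFactorial (show δ ≤ n by omega), mul_comm]
      refine Nat.mul_le_mul_left _ ((Nat.pow_le_pow_left (by omega) δ).trans
        (Nat.pow_sub_le_descFactorial n δ))
    have h₂ : (n : ℝ) ^ δ ≤ 2 * ((n - δ : ℕ) : ℝ) ^ δ := by
      have h₃ : (1 : ℝ) / 2 ≤ (1 + -(δ / n : ℝ)) ^ δ := by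
        have h₄ : (δ / n : ℝ) ≤ 1 := by
          rw [div_le_one hn0]
          exact_mod_cast (show δ ≤ n by omega)
        refine le_trans ?_ (one_add_mul_le_pow (by linarith) δ)
        have h₅ : (δ : ℝ) * (δ / n) ≤ 1 / 2 := by
          rw [← mul_div_assoc, div_le_iff₀ hn0]
          have : (2 : ℝ) * δ ^ 2 ≤ n := by exact_mod_cast hlarge
          linarith
        linarith
      have h₆ : ((n - δ : ℕ) : ℝ) = n * (1 + -(δ / n : ℝ)) := by
        rw [Nat.cast_sub (by omega)]
        field_simp
        ring
      rw [h₆, mul_pow]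
      nlinarith [pow_pos hn0 δ]
    calc (n : ℝ) ^ δ * (n - δ).factorial ≤ 2 * ((n - δ : ℕ) : ℝ) ^ δ * (n - δ).factorial := by
          gcongr
      _ = 2 * (((n - δ) ^ δ * (n - δ).factorial : ℕ) : ℝ) := by
          push_cast
          ring
      _ ≤ 2 * n.factorial := by
          gcongr
  have hhalf : 2 * (Finset.univ.filter fun σ : Equiv.Perm (Fin n) =>
      ¬ IsDense (pattern s) δ (parity (permVec σ))).card ≤ n.factorial := by
    have h₁ : ((n * ((n - δ).factorial * (n ^ (2 * s) - (n / 2) ^ (2 * s)) ^ M) : ℕ) : ℝ) ≤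
        n.factorial / 2 := by
      calc ((n * ((n - δ).factorial * (n ^ (2 * s) - (n / 2) ^ (2 * s)) ^ M) : ℕ) : ℝ)
          = n * ((n - δ).factorial * (n ^ (2 * s) * (1 - ((4 : ℝ) ^ s)⁻¹)) ^ M) := by
            rw [← hpow]
            norm_cast
        _ = n ^ δ * (n - δ).factorial * (n * (1 - ((4 : ℝ) ^ s)⁻¹) ^ M) := by
            rw [mul_pow, ← pow_mul, ← hδM]
            ring
        _ ≤ n ^ δ * (n - δ).factorial * (n * Real.exp (-L)) := by gcongr
        _ ≤ 2 * n.factorial * (1 / 4) := by gcongr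
        _ = n.factorial / 2 := by ring
    have h₂ := (Nat.cast_le (α := ℝ)).2 hcount
    have h₃ : (2 : ℝ) * (Finset.univ.filter fun σ : Equiv.Perm (Fin n) =>
      ¬ IsDense (pattern s) δ (parity (permVec σ))).card ≤ n.factorial := by linarith
    exact_mod_cast h₃
  have htotal := Finset.card_filter_add_card_filter_not (s := Finset.univ)
    fun σ : Equiv.Perm (Fin n) => IsDense (pattern s) δ (parity (permVec σ))
  rw [Finset.card_univ, Fintype.card_perm, Fintype.card_fin] at htotal
  omega

/-! ### Choice of the parameters -/

/-- The parameters that matter for the code. -/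
abbrev FiniteParams (n s : ℕ) : Type :=
  ZMod 4 × ZMod (2 * n) × (∀ k : Finset.Icc 1 s, ZMod (windowLen n s k) × ZMod 2) ×
    (∀ k : Finset.Icc 2 s, ZMod (2 * windowLen n s k * k) × ZMod (2 * windowLen n s k * k)) ×
    ZMod (2 * (2 * s)).factorial × ZMod (2 * (2 * s)).factorial

theorem card_finiteParams (n s : ℕ) : Nat.card (FiniteParams n s) =
    4 * (2 * n * ((∏ k ∈ Finset.Icc 1 s, windowLen n s k * 2) *
      ((∏ k ∈ Finset.Icc 2 s, (2 * windowLen n s k * k) ^ 2) *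
        ((2 * (2 * s)).factorial * (2 * (2 * s)).factorial)))) := by
  simp only [FiniteParams, Nat.card_prod, Nat.card_pi, Nat.card_zmod]
  rw [Finset.prod_coe_sort (Finset.Icc 1 s) fun k => windowLen n s k * 2,
    Finset.prod_coe_sort (Finset.Icc 2 s)
      fun k => 2 * windowLen n s k * k * (2 * windowLen n s k * k)]
  simp only [sq]

theorem Admissible.mul_windowLen_le {n s k : ℕ} (h : Admissible n s) (hs : 1 ≤ s) (hk : 1 ≤ k)
    (hks : k ≤ s) : k * windowLen n s k ≤ 2 * delta n s := by
  have := h.le_delta hs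
  have := (windowLen_bounds (n := n) (s := s) hk).2
  omega

/-- The exponent is `s` from the `b` parameters plus `2 * (s - 1)` from the `c` parameters. -/
theorem Admissible.card_finiteParams_le {n s : ℕ} (h : Admissible n s) (hs : 1 ≤ s) :
    Nat.card (FiniteParams n s) ≤
      8 * (2 * (2 * s)).factorial ^ 2 * n * (4 * delta n s) ^ (3 * s - 2) := by
  have h₁ : ∏ k ∈ Finset.Icc 1 s, windowLen n s k * 2 ≤ (4 * delta n s) ^ s := by
    refine (Finset.prod_le_pow_card _ _ (4 * delta n s) fun k hk => ?_).trans ?_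
    · rw [Finset.mem_Icc] at hk
      have h₁ := h.mul_windowLen_le hs hk.1 hk.2
      have h₂ := Nat.le_mul_of_pos_left (windowLen n s k) hk.1
      omega
    · simp
  have h₂ : ∏ k ∈ Finset.Icc 2 s, (2 * windowLen n s k * k) ^ 2 ≤
      ((4 * delta n s) ^ 2) ^ (s - 1) := by
    refine (Finset.prod_le_pow_card _ _ ((4 * delta n s) ^ 2) fun k hk => ?_).trans ?_
    · rw [Finset.mem_Icc] at hk
      refine Nat.pow_le_pow_left ?_ 2
      have h₁ := h.mul_windowLen_le hs (by omega) hk.2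
      rw [mul_assoc, mul_comm (windowLen n s k)]
      omega
    · simp
  rw [card_finiteParams]
  calc _ ≤ 4 * (2 * n * ((4 * delta n s) ^ s * (((4 * delta n s) ^ 2) ^ (s - 1) *
        ((2 * (2 * s)).factorial * (2 * (2 * s)).factorial)))) := by gcongr
    _ = 8 * (2 * (2 * s)).factorial ^ 2 * n * ((4 * delta n s) ^ s *
        ((4 * delta n s) ^ 2) ^ (s - 1)) := by ring
    _ = _ := by
      rw [← pow_mul, ← pow_add]
      congr 2
      omega

/-- The parameters of the code given by the ones that matter. -/
def FiniteParams.toParams {n s : ℕ} (f : FiniteParams n s) : Params n s where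
  a₁ := f.1
  a₂ := f.2.1
  bOdd k := if h : k ∈ Finset.Icc 1 s then (f.2.2.1 ⟨k, h⟩).1 else 0
  bEven k := if h : k ∈ Finset.Icc 1 s then (f.2.2.1 ⟨k, h⟩).2 else 0
  cOdd k := if h : k ∈ Finset.Icc 2 s then (f.2.2.2.1 ⟨k, h⟩).1 else 0
  cEven k := if h : k ∈ Finset.Icc 2 s then (f.2.2.2.1 ⟨k, h⟩).2 else 0
  d₁ := f.2.2.2.2.1
  d₂ := f.2.2.2.2.2

theorem exists_mem_code_toParams {n s : ℕ} (hs : 1 ≤ s) {σ : Equiv.Perm (Fin n)} {q : Params n s}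
    (hσ : σ ∈ code n s q) : ∃ f : FiniteParams n s, σ ∈ code n s f.toParams := by
  refine ⟨⟨q.a₁, q.a₂, fun k => (q.bOdd k, q.bEven k), fun k => (q.cOdd k, q.cEven k), q.d₁, q.d₂⟩,
    hσ.1, ?_, hσ.2.2.1, fun k hk hks => ?_⟩
  · have h₁ : 1 ∈ Finset.Icc 1 s := Finset.mem_Icc.2 ⟨le_rfl, hs⟩
    simp only [FiniteParams.toParams, dif_pos h₁]
    exact hσ.2.1
  · have h₁ : k ∈ Finset.Icc 1 s := Finset.mem_Icc.2 ⟨by omega, hks⟩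
    have h₂ : k ∈ Finset.Icc 2 s := Finset.mem_Icc.2 ⟨hk, hks⟩
    simp only [FiniteParams.toParams, dif_pos h₁, dif_pos h₂]
    exact hσ.2.2.2 k hk hks

/-- Every permutation with a dense parity word lies in one of the codes. -/
theorem exists_mem_code {n s : ℕ} {σ : Equiv.Perm (Fin n)}
    (hσ : IsDense (pattern s) (delta n s) (parity (permVec σ))) :
    ∃ q : Params n s, σ ∈ code n s q := by
  -- The case `k = 1` is separate because the code takes the signature of the whole vector there,
  -- not of a first row.
  refine ⟨⟨_, _, fun k => ((if k = 1 then VT (fun i => (signature (permVec σ) i : ℕ))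
      else VT (fun i => (signature (firstRow k (permVec σ)) i : ℕ)) : ℕ) : ZMod _),
    fun k => ((if k = 1 then ∑ i, (signature (permVec σ) i : ℕ)
      else ∑ i, (signature (firstRow k (permVec σ)) i : ℕ) : ℕ) : ZMod 2),
    fun k => ((∑ i ∈ Finset.range (n / (2 * windowLen n s k * k)),
      firstRowSum k (blockPair (windowLen n s k * k) (permVec σ) (2 * i)) : ℕ) : ZMod _),
    fun k => ((∑ i ∈ Finset.range (n / (2 * windowLen n s k * k)),
      firstRowSum k (blockPair (windowLen n s k * k) (permVec σ) (2 * i + 1)) : ℕ) : ZMod _),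
    _, _⟩, ⟨hσ, rfl, rfl⟩, ⟨rfl, rfl⟩, ⟨rfl, rfl⟩, fun k hk hks => ⟨⟨rfl, rfl⟩, ?_⟩⟩
  have hk₁ : k ≠ 1 := by omega
  simp only [if_neg hk₁]
  exact ⟨rfl, rfl⟩

/-- Some choice of the parameters gives a code that contains an average share of any given set of
permutations with dense parity words. -/
theorem exists_large_code {n s : ℕ} (hs : 1 ≤ s) (hn : Admissible n s)
    {D : Finset (Equiv.Perm (Fin n))} (hD : D.Nonempty)
    (hdense : ∀ σ ∈ D, IsDense (pattern s) (delta n s) (parity (permVec σ))) :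
    ∃ q : Params n s, (code n s q).Nonempty ∧
      D.card ≤ (code n s q).ncard * Nat.card (FiniteParams n s) := by
  classical
  have hfin : ∀ k : Finset.Icc 1 s, Finite (ZMod (windowLen n s k)) := fun k => by
    have hk := Finset.mem_Icc.1 k.2
    have : NeZero (windowLen n s k) := ⟨(hn.windowLen_pos hk.1 hk.2).ne'⟩
    infer_instance
  have hfin' : ∀ k : Finset.Icc 2 s, Finite (ZMod (2 * windowLen n s k * k)) := fun k => by
    have hk := Finset.mem_Icc.1 k.2
    have h₁ := hn.windowLen_pos (k := k) (by omega) hk.2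
    have h₂ : 0 < (k : ℕ) := by omega
    have : NeZero (2 * windowLen n s k * k) := ⟨by positivity⟩
    infer_instance
  have : NeZero n := ⟨hn.1.ne'⟩
  have : NeZero (2 * (2 * s)).factorial := ⟨Nat.factorial_ne_zero _⟩
  have : Finite (FiniteParams n s) := inferInstance
  have := Fintype.ofFinite (FiniteParams n s)
  have hf : ∀ σ : Equiv.Perm (Fin n), ∃ f : FiniteParams n s, σ ∈ D → σ ∈ code n s f.toParams := by
    intro σ
    by_cases hσ : σ ∈ D
    · obtain ⟨q, hq⟩ := exists_mem_code (hdense σ hσ)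
      obtain ⟨f, hf⟩ := exists_mem_code_toParams hs hq
      exact ⟨f, fun _ => hf⟩
    · exact ⟨(0, 0, 0, 0, 0, 0), fun h => absurd h hσ⟩
  choose F hF using hf
  -- Pigeonhole: the largest fibre of `F`. Maximizing over the image of `D` keeps the code nonempty.
  obtain ⟨f, hfD, hmax⟩ := Finset.exists_max_image (D.image F)
    (fun f => (D.filter fun σ => F σ = f).card) (hD.image F)
  refine ⟨f.toParams, ?_, ?_⟩
  · obtain ⟨σ, hσ, rfl⟩ := Finset.mem_image.1 hfD
    exact ⟨σ, hF σ hσ⟩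
  · have h₁ := Finset.card_le_mul_card_image D _ hmax
    refine h₁.trans (Nat.mul_le_mul ?_ ?_)
    · rw [← Set.ncard_coe_finset]
      refine Set.ncard_le_ncard (fun σ hσ => ?_) (Set.toFinite _)
      obtain ⟨hσD, rfl⟩ := Finset.mem_filter.1 (Finset.mem_coe.1 hσ)
      exact hF σ hσD
    · rw [Nat.card_eq_fintype_card]
      exact Finset.card_le_univ _

/-! ### Large lengths and logarithmic estimates. -/

theorem exists_large_threshold (s : ℕ) :
    ∃ N₀ : ℕ, ∀ n, N₀ ≤ n → 2 * delta n s ^ 2 ≤ n ∧ 5 ≤ Nat.clog 2 n := by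
  set c := s * 2 ^ (2 * s + 1) with hc
  have hlim := tendsto_pow_const_div_const_pow_of_one_lt 2 (one_lt_two (α := ℝ))
  have hpos : (0 : ℝ) < 1 / (4 * c ^ 2 + 1) := by positivity
  obtain ⟨L₀, hL₀⟩ := Filter.eventually_atTop.1 (hlim.eventually_lt_const hpos)
  refine ⟨2 ^ max L₀ 5, fun n hn => ?_⟩
  have hclog : max L₀ 5 ≤ Nat.clog 2 n := by
    rw [← Nat.clog_pow 2 (max L₀ 5) one_lt_two]
    exact Nat.clog_mono_right 2 hn
  refine ⟨?_, (le_max_right _ _).trans hclog⟩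
  have h₁ := hL₀ (Nat.clog 2 n) ((le_max_left _ _).trans hclog)
  rw [div_lt_div_iff₀ (by positivity) (by positivity), one_mul] at h₁
  have h₂ : Nat.clog 2 n ^ 2 * (4 * c ^ 2 + 1) < 2 ^ Nat.clog 2 n := by exact_mod_cast h₁
  have h₃ : 5 ≤ Nat.clog 2 n := (le_max_right _ _).trans hclog
  have hn1 : 1 < n := by
    by_contra h
    rw [Nat.clog_of_right_le_one (by omega)] at h₃
    omega
  have h₄ := Nat.pow_pred_clog_lt_self one_lt_two hn1
  have h₅ : 2 ^ Nat.clog 2 n = 2 * 2 ^ (Nat.clog 2 n).pred := by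
    rw [← pow_succ', Nat.pred_eq_sub_one]
    congr 1
    omega
  have h₆ : 2 * (2 * delta n s ^ 2) ≤ Nat.clog 2 n ^ 2 * (4 * c ^ 2 + 1) := by
    rw [delta, ← hc]
    nlinarith [sq_nonneg (Nat.clog 2 n)]
  omega

theorem one_le_logb_of_two_le {n : ℕ} (hn : 2 ≤ n) : 1 ≤ Real.logb 2 n := by
  rw [Real.le_logb_iff_rpow_le one_lt_two (by positivity), Real.rpow_one]
  exact_mod_cast hn

theorem clog_le_two_mul_logb {n : ℕ} (hn : 2 ≤ n) : (Nat.clog 2 n : ℝ) ≤ 2 * Real.logb 2 n := by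
  have h₁ := one_le_logb_of_two_le hn
  have h₂ := Real.natCeil_logb_natCast 2 n
  rw [← h₂]
  have := Nat.ceil_lt_add_one (a := Real.logb (2 : ℕ) n) (by push_cast; linarith)
  push_cast at this ⊢
  linarith

theorem redundancy_le_of_factorial_le {n : ℕ} {C : Set (Equiv.Perm (Fin n))} (hC : C.Nonempty)
    {B : ℝ} (h : (n.factorial : ℝ) ≤ C.ncard * B) : redundancy C ≤ Real.logb 2 B := by
  have hcard : (0 : ℝ) < C.ncard := by
    exact_mod_cast (Set.ncard_pos (Set.toFinite C)).2 hC
  have hfact : (0 : ℝ) < n.factorial := by exact_mod_cast n.factorial_pos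
  have hB : 0 < B := pos_of_mul_pos_right (hfact.trans_le h) hcard.le
  rw [redundancy, Nat.card_perm, Nat.card_fin, sub_le_iff_le_add', ← Real.logb_mul hcard.ne' hB.ne']
  exact Real.logb_le_logb_of_le one_lt_two hfact h

end BurstDeletion

open BurstDeletion in
theorem mainTheorem4 (s : ℕ) (hs : 1 ≤ s) :
    (∀ n : ℕ, BurstDeletion.Admissible n s → ∀ q : BurstDeletion.Params n s,
      BurstDeletion.IsLeBSDCode s (BurstDeletion.code n s q)) ∧
    ∃ K : ℝ, ∀ n : ℕ, BurstDeletion.Admissible n s → ∃ q : BurstDeletion.Params n s,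
      (BurstDeletion.code n s q).Nonempty ∧
      BurstDeletion.IsLeBSDCode s (BurstDeletion.code n s q) ∧
      BurstDeletion.redundancy (BurstDeletion.code n s q) ≤
        Real.logb 2 n + (3 * (s : ℝ) - 2) * Real.logb 2 (Real.logb 2 n) + K := by
  classical
  refine ⟨fun n hn q => isLeBSDCode_code hs hn q, ?_⟩
  obtain ⟨N₀, hN₀⟩ := exists_large_threshold s
  -- 16 is the 8 of `card_finiteParams_le` times 2 for the dense half; the inner 8 comes from `4 *
  -- δ` and `⌈log n⌉ ≤ 2 log n`.
  set A : ℝ := 16 * (2 * (2 * s)).factorial ^ 2 * (8 * (s * 2 ^ (2 * s + 1))) ^ (3 * s - 2) with hA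
  have hs' : (1 : ℝ) ≤ s := by exact_mod_cast hs
  have hA1 : 1 ≤ A := by
    have h₁ : (1 : ℝ) ≤ (2 * (2 * s)).factorial := by exact_mod_cast Nat.factorial_pos _
    have h₂ : (1 : ℝ) ≤ 2 ^ (2 * s + 1) := one_le_pow₀ one_le_two
    have h₃ : (1 : ℝ) ≤ 8 * (s * 2 ^ (2 * s + 1)) := by nlinarith
    have h₄ : (1 : ℝ) ≤ (8 * (s * 2 ^ (2 * s + 1))) ^ (3 * s - 2) := one_le_pow₀ h₃
    have h₅ : (1 : ℝ) ≤ (2 * (2 * s)).factorial ^ 2 := one_le_pow₀ h₁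
    rw [hA]
    nlinarith
  have hAlog : 0 ≤ Real.logb 2 A := Real.logb_nonneg one_lt_two hA1
  have hNlog : 0 ≤ Real.logb 2 N₀.factorial :=
    Real.logb_nonneg one_lt_two (by exact_mod_cast N₀.factorial_pos)
  refine ⟨Real.logb 2 A + Real.logb 2 N₀.factorial, fun n hn => ?_⟩
  have hn2 : 2 ≤ n := by
    have := hn.le_delta hs
    have := hn.two_mul_delta_le hs
    omega
  have hlog := one_le_logb_of_two_le hn2
  have hloglog : 0 ≤ Real.logb 2 (Real.logb 2 n) := Real.logb_nonneg one_lt_two hlog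
  -- Below `N₀`, a nonempty code has redundancy at most `log N₀!`, which is part of `K`; this needs
  -- `log log n ≥ 0`.
  rcases lt_or_ge n N₀ with hsmall | hlarge
  · obtain ⟨σ, hσ⟩ := exists_dense hs hn
    obtain ⟨q, hq⟩ := exists_mem_code hσ
    refine ⟨q, ⟨σ, hq⟩, isLeBSDCode_code hs hn q, ?_⟩
    have hcard : (1 : ℝ) ≤ (code n s q).ncard := by
      exact_mod_cast (Set.ncard_pos (Set.toFinite _)).2 ⟨σ, hq⟩
    have hred : redundancy (code n s q) ≤ Real.logb 2 N₀.factorial := by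
      refine redundancy_le_of_factorial_le ⟨σ, hq⟩ ?_
      have h₁ : (n.factorial : ℝ) ≤ N₀.factorial := by
        exact_mod_cast Nat.factorial_le hsmall.le
      have h₂ : (0 : ℝ) ≤ N₀.factorial := Nat.cast_nonneg _
      nlinarith
    have hmul : 0 ≤ (3 * (s : ℝ) - 2) * Real.logb 2 (Real.logb 2 n) :=
      mul_nonneg (by linarith) hloglog
    linarith
  · obtain ⟨hδ, hL⟩ := hN₀ n hlarge
    have hhalf := factorial_le_two_mul_card_dense hs hn hδ hL
    have hDpos : (Finset.univ.filter fun σ : Equiv.Perm (Fin n) =>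
        IsDense (pattern s) (delta n s) (parity (permVec σ))).Nonempty := by
      refine Finset.card_pos.1 ?_
      have := n.factorial_pos
      omega
    obtain ⟨q, hq, hcard⟩ := exists_large_code hs hn hDpos fun σ hσ => (Finset.mem_filter.1 hσ).2
    refine ⟨q, hq, isLeBSDCode_code hs hn q, ?_⟩
    have hT := hn.card_finiteParams_le hs
    have hfact : (n.factorial : ℝ) ≤
        (code n s q).ncard * (A * (n * Real.logb 2 n ^ (3 * s - 2))) := by
      have h₁ : n.factorial ≤ (code n s q).ncard *
          (16 * (2 * (2 * s)).factorial ^ 2 * n * (4 * delta n s) ^ (3 * s - 2)) := by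
        have := Nat.mul_le_mul_left ((code n s q).ncard) hT
        nlinarith
      have h₂ : (4 * delta n s : ℝ) ≤ 8 * (s * 2 ^ (2 * s + 1)) * Real.logb 2 n := by
        rw [delta]
        push_cast
        have h₃ := clog_le_two_mul_logb hn2
        have h₄ : (0 : ℝ) ≤ s * 2 ^ (2 * s + 1) := by positivity
        nlinarith
      calc (n.factorial : ℝ) ≤ (code n s q).ncard *
          (16 * (2 * (2 * s)).factorial ^ 2 * n * (4 * delta n s) ^ (3 * s - 2)) := by
            exact_mod_cast h₁
        _ ≤ (code n s q).ncard * (16 * (2 * (2 * s)).factorial ^ 2 * n *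
            (8 * (s * 2 ^ (2 * s + 1)) * Real.logb 2 n) ^ (3 * s - 2)) := by gcongr
        _ = _ := by
            rw [hA, mul_pow _ (Real.logb 2 n)]
            ring
    refine (redundancy_le_of_factorial_le hq hfact).trans ?_
    have hn0 : (n : ℝ) ≠ 0 := by positivity
    have hl0 : Real.logb 2 n ^ (3 * s - 2) ≠ 0 := by positivity
    rw [Real.logb_mul (by positivity) (mul_ne_zero hn0 hl0), Real.logb_mul hn0 hl0, Real.logb_pow,
      Nat.cast_sub (by omega)]
    push_cast
    linarith
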